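/- All graphs are finite and simple. For a graph $G$ let $Q(G)=D(G)+A(G)$ be its signless Laplacian matrix (degree matrix plus adjacency matrix), let $q_{\min}(G)$ be the least eigenvalue of $Q(G)$, and let $\gamma(G)$ be the domination number of $G$. For integers $n,k,g$ with $g\ge 3$ odd, $g<n$ and $1\le k\le n-g$, let $U_n^k(g)$ be the graph of order $n$ obtained from a cycle $C_g$ and a star with $k$ leaves by joining one vertex of the cycle to the center of the star by a path on $l=n+1-g-k$ vertices, the end vertices of the path being that cycle vertex and the center (if $l=1$, the cycle vertex and the center are identified). Put $\gamma_g=\gamma(U_n^1(g))$. Theorem. Let $g\ge 3$ be odd, let $n>g$, and let $\gamma$ be an integer with $\lceil g/3\rceil\le\gamma\le\gamma_g$. Then some $U_n^k(g)$ with $1\le k\le n-g$ has domination number $\gamma$; let $V_n^\gamma(g)$ denote the one with the smallest such $k$. Let $\mathscr{G}_n^\gamma(g)$ be the class of all connected non-bipartite graphs of order $n$ with domination number $\gamma$ whose shortest odd cycle has length $g$. Then $V_n^\gamma(g)\in\mathscr{G}_n^\gamma(g)$, and for every $G\in\mathscr{G}_n^\gamma(g)$ we have $q_{\min}(G)\ge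 q_{\min}(V_n^\gamma(g))$, with equality if and only if $G$ is isomorphic to $V_n^\gamma(g)$. -/

import Mathlib

open Classical in
/-- The signless Laplacian matrix `Q(G) = D(G) + A(G)`. -/
noncomputable def SimpleGraph.signlessLaplacian {V : Type*} [Fintype V] (G : SimpleGraph V) :
    Matrix V V ℝ :=
  G.degMatrix ℝ + G.adjMatrix ℝ

open Classical in
/-- The least eigenvalue `q_min(G)` of the signless Laplacian matrix. (The spectrum of a real
symmetric matrix is a finite set of real numbers, nonempty as soon as `V` is nonempty.) -/
noncomputable def SimpleGraph.qMin {V : Type*} [Fintype V] (G : SimpleGraph V) : ℝ :=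
  sInf (spectrum ℝ G.signlessLaplacian)

/-- `S` is a dominating set of `G`: every vertex outside `S` has a neighbour in `S`. -/
def SimpleGraph.IsDominatingSet {V : Type*} (G : SimpleGraph V) (S : Finset V) : Prop :=
  ∀ v, v ∉ S → ∃ u ∈ S, G.Adj v u

/-- The domination number of `G`: the least cardinality of a dominating set. -/
noncomputable def SimpleGraph.dominationNumber {V : Type*} (G : SimpleGraph V) : ℕ :=
  sInf {m | ∃ S : Finset V, G.IsDominatingSet S ∧ S.card = m}

/-- The set of lengths of the odd cycles of `G`. -/
def SimpleGraph.oddCycleLengths {V : Type*} (G : SimpleGraph V) : Set ℕ :=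
  {m | Odd m ∧ ∃ (v : V) (c : G.Walk v v), c.IsCycle ∧ c.length = m}

/-- `G` is a connected non-bipartite graph of order `n` with domination number `γ`
in which the minimum length of an odd cycle is `g`. -/
structure SimpleGraph.InClass (n γ g : ℕ) {V : Type*} [Fintype V] (G : SimpleGraph V) : Prop where
  order : Fintype.card V = n
  connected : G.Connected
  not_bipartite : ¬ G.IsBipartite
  domination : G.dominationNumber = γ
  odd_girth : IsLeast G.oddCycleLengths g

/-- The graph `U_n^k(g)`, for `3 ≤ g < n` and `1 ≤ k ≤ n - g`, on the vertices `0, …, n - 1`.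
The vertices `0, …, g - 1` form the cycle `C_g`, the `l = n + 1 - g - k` vertices
`g - 1, g, …, n - 1 - k` form a path which leads from the cycle vertex `g - 1` to the vertex
`n - 1 - k`, and this last vertex (equal to `g - 1` if `l = 1`) is the centre of a star whose `k`
leaves are `n - k, …, n - 1`. -/
def cyclePathStar (n k g : ℕ) : SimpleGraph (Fin n) :=
  SimpleGraph.fromRel fun i j : Fin n =>
    -- consecutive vertices among `0, …, n - 1 - k`: the cycle without one edge, and the path
    ((j : ℕ) = i + 1 ∧ (j : ℕ) + k + 1 ≤ n) ∨
    -- the edge that closes the cycle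
    ((i : ℕ) = 0 ∧ (j : ℕ) + 1 = g) ∨
    -- the edges of the star
    ((i : ℕ) + k + 1 = n ∧ (i : ℕ) < j)

/-- The admissible numbers `k` for which `U_n^k(g)` has domination number `γ`. -/
def leafCounts (n γ g : ℕ) : Set ℕ :=
  {k | 1 ≤ k ∧ k ≤ n - g ∧ (cyclePathStar n k g).dominationNumber = γ}

/-- The graph `V_n^γ(g)`: the graph `U_n^k(g)` with domination number `γ` for which `k` is
minimum. -/
noncomputable def extremalGraph (n γ g : ℕ) : SimpleGraph (Fin n) :=
  cyclePathStar n (sInf (leafCounts n γ g)) g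

/-!
Write `q` for the least eigenvalue of `Q(U)`, where `U = U_n^k(g)` is the extremal graph, and `m`
for the distance of the centre of its star from the cycle, so that `n = g + m + k`. The proof
separates a bound on the domination number from a bound on the spectrum; what links them is the
greatest distance of a vertex from a shortest odd cycle.

*Domination.* Let `G` be in the class, let `S` be a minimum dominating set, and let `C` be a
shortest odd cycle with as many vertices in `S` as possible. If `d` is the greatest distance of a
vertex from `C`, then `g + d ≤ 3 γ`, or `g + d ≤ 3 γ + 1` in case `3 ∣ g`
(`SimpleGraph.exists_rootedCycle_add_depth_le`): a vertex dominates at most three vertices of `C`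
and at most three vertices of a shortest path to `C`, and the choice of `C` limits what a vertex
of `S` can do for both at once. On the other hand this inequality is sufficient for the graph
`U_n^{k'}(g)` with leaves at distance `d` from the cycle to have domination number at most `γ`
(`cyclePathStar.dominationNumber_le`). The domination number of `U_n^{k'}(g)` grows by at most one
when `k'` decreases by one, so the minimality of `k` gives `k ≤ k'`, that is `d ≤ m + 1`.

*Spectrum.* Let every vertex of `G` have distance at most `m + 1` from `C`. It is to be shown that
`xᵀ Q(G) x - q xᵀ x ≥ 0` for all `x` (`SimpleGraph.RootedCycle.le_energy`). All edges are dropped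
but those of `C` and, for each vertex off the cycle, one edge to a parent closer to `C`. Let `u` be
a vertex at which `|x|` is maximal among the vertices at distance at most `m` from `C`. Then each
vertex off the path from `C` to `u` contributes at least `-q / (1 - q) * x u ^ 2`, which is the
contribution of an optimal leaf attached to `u`. What remains is the form of a cycle with a path of
length at most `m` and leaves at its end. If the path is extended to length `m` by values that grow
by the factor `-1 / (1 - q)`, then the form does not increase
(`SimpleGraph.TailNonneg.shorten`), and the result is the form of `U`, which is nonnegative.

*Equality.* If equality holds at some `x ≠ 0`, then all of these estimates are tight. This puts `u`
at distance `m`, all vertices off the path at distance `m + 1`, next to `u`, and rules out any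
further edge (`SimpleGraph.RootedCycle.isBroom_of_energy_eq`). Hence `G` is isomorphic to `U`.
-/

/-! ### Odd closed walks -/

namespace SimpleGraph

variable {V : Type*} {G : SimpleGraph V}

/-- A closed walk of odd length which is not a cycle splits at a repeated vertex into two shorter
closed walks, one of which has odd length. -/
theorem Walk.exists_isCycle_odd_length_le {u : V} (p : G.Walk u u) (hp : Odd p.length) :
    ∃ (v : V) (c : G.Walk v v), c.IsCycle ∧ Odd c.length ∧ c.length ≤ p.length := by
  induction hl : p.length using Nat.strong_induction_on generalizing u p with
  | _ l ih =>
    subst hl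
    by_cases hpath : p.tail.IsPath
    · refine ⟨u, p, Walk.isCycle_iff_isPath_tail_and_le_length.2 ⟨hpath, ?_⟩, hp, le_rfl⟩
      have h1 : p.length ≠ 1 := fun h => G.loopless.irrefl u (Walk.adj_of_length_eq_one h)
      obtain ⟨m, hm⟩ := hp
      omega
    · rw [← Walk.IsPath.getVert_injOn_iff] at hpath
      have hlen : p.tail.length + 1 = p.length := by
        apply Walk.length_tail_add_one
        intro hnil
        rw [Walk.length_eq_zero_iff.2 hnil] at hp
        simp at hp
      obtain ⟨i, j, hij, hj, heq⟩ : ∃ i j, i < j ∧ j ≤ p.length - 1 ∧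
          p.getVert (i + 1) = p.getVert (j + 1) := by
        simp only [Set.InjOn, not_forall] at hpath
        obtain ⟨i, hi, j, hj, he, hne⟩ := hpath
        simp only [Walk.getVert_tail] at he
        have hi' : i ≤ p.tail.length := hi
        have hj' : j ≤ p.tail.length := hj
        rcases lt_or_gt_of_ne hne with h | h
        · exact ⟨i, j, h, by omega, he⟩
        · exact ⟨j, i, h, by omega, he.symm⟩
      by_cases hodd : Odd (j - i)
      · have hv : (p.drop (i + 1)).getVert (j - i) = p.getVert (i + 1) := by
          rw [Walk.drop_getVert, heq]; congr 1; omega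
        have hlq : (((p.drop (i + 1)).take (j - i)).copy rfl hv).length = j - i := by
          rw [Walk.length_copy, Walk.take_length, Walk.drop_length]; omega
        obtain ⟨v, c, h1, h2, h3⟩ := ih _ (by omega)
          (((p.drop (i + 1)).take (j - i)).copy rfl hv) (by rwa [hlq]) rfl
        exact ⟨v, c, h1, h2, by omega⟩
      · have hlq : ((p.take (i + 1)).append ((p.drop (j + 1)).copy heq.symm rfl)).length
            = p.length - (j - i) := by
          rw [Walk.length_append, Walk.length_copy, Walk.take_length, Walk.drop_length]; omega
        have hodd' : Odd (p.length - (j - i)) := by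
          rw [Nat.not_odd_iff_even] at hodd
          exact Nat.Odd.sub_even (by omega) hp hodd
        obtain ⟨v, c, h1, h2, h3⟩ := ih _ (by omega)
          ((p.take (i + 1)).append ((p.drop (j + 1)).copy heq.symm rfl)) (by rwa [hlq]) rfl
        exact ⟨v, c, h1, h2, by omega⟩

/-- The odd girth bounds the length of every closed walk of odd length. -/
theorem le_length_of_isLeast_oddCycleLengths {g : ℕ} (h : IsLeast G.oddCycleLengths g) {u : V}
    (p : G.Walk u u) (hp : Odd p.length) : g ≤ p.length := by
  obtain ⟨v, c, hc, hodd, hle⟩ := p.exists_isCycle_odd_length_le hp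
  exact (h.2 ⟨hodd, v, c, hc, rfl⟩).trans hle

/-! ### The quadratic form of the signless Laplacian -/

variable [Fintype V]

/-- The quadratic form `x ↦ xᵀ Q(G) x` of the signless Laplacian. -/
noncomputable def energy (G : SimpleGraph V) (x : V → ℝ) : ℝ :=
  x ⬝ᵥ (G.signlessLaplacian.mulVec x)

open Classical in
theorem energy_eq_sum (G : SimpleGraph V) (x : V → ℝ) :
    2 * G.energy x = ∑ i, ∑ j, if G.Adj i j then (x i + x j) ^ 2 else 0 := by
  have h1 : G.energy x = ∑ i, ∑ j, if G.Adj i j then x i * x i + x i * x j else 0 := by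
    simp_rw [energy, signlessLaplacian, Matrix.add_mulVec, dotProduct_add,
      dotProduct_mulVec_degMatrix, dotProduct_mulVec_adjMatrix, degree_eq_sum_if_adj,
      Finset.sum_mul, ite_mul, one_mul, zero_mul, ← Finset.sum_add_distrib, ite_add_ite, add_zero]
  have h2 : G.energy x = ∑ i, ∑ j, if G.Adj i j then x j * x j + x i * x j else 0 := by
    rw [h1, Finset.sum_comm]
    simp_rw [G.adj_comm, mul_comm (x _) (x _)]
  rw [two_mul]
  nth_rw 1 [h1]
  rw [h2]
  simp_rw [← Finset.sum_add_distrib, ite_add_ite, add_zero]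
  congr! 6
  ring

theorem energy_nonneg (G : SimpleGraph V) (x : V → ℝ) : 0 ≤ G.energy x := by
  classical
  have h := G.energy_eq_sum x
  have : 0 ≤ 2 * G.energy x := by
    rw [h]; positivity
  linarith

open Classical in
theorem isHermitian_signlessLaplacian (G : SimpleGraph V) : G.signlessLaplacian.IsHermitian :=
  (G.isHermitian_degMatrix ℝ).add (G.isHermitian_adjMatrix ℝ)

open Classical in
theorem qMin_isLeast [Nonempty V] (G : SimpleGraph V) :
    IsLeast (spectrum ℝ G.signlessLaplacian) G.qMin := by
  have h := G.isHermitian_signlessLaplacian.spectrum_real_eq_range_eigenvalues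
  rw [qMin, h]
  exact ⟨(Set.range_nonempty _).csInf_mem (Set.finite_range _),
    fun y hy => csInf_le (Set.finite_range _).bddBelow hy⟩

open Classical in
/-- The Rayleigh bound for the least eigenvalue. -/
theorem qMin_mul_le_energy [Nonempty V] (G : SimpleGraph V) (x : V → ℝ) :
    G.qMin * ∑ v, x v ^ 2 ≤ G.energy x := by
  have hpos : (G.signlessLaplacian - algebraMap ℝ _ G.qMin).PosSemidef := by
    rw [Matrix.posSemidef_iff_isHermitian_and_spectrum_nonneg]
    refine ⟨G.isHermitian_signlessLaplacian.sub ?_, ?_⟩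
    · rw [Matrix.algebraMap_eq_diagonal]
      exact Matrix.isHermitian_diagonal _
    · intro a ha
      rw [← spectrum.sub_singleton_eq] at ha
      obtain ⟨b, hb, c, hc, rfl⟩ := ha
      rw [Set.mem_singleton_iff] at hc
      subst hc
      exact sub_nonneg.2 (G.qMin_isLeast.2 hb)
  have h := hpos.dotProduct_mulVec_nonneg x
  rw [star_trivial, Matrix.sub_mulVec, dotProduct_sub, Algebra.algebraMap_eq_smul_one,
    Matrix.smul_mulVec, Matrix.one_mulVec, dotProduct_smul] at h
  rw [energy]
  have h2 : x ⬝ᵥ x = ∑ v, x v ^ 2 := by simp [dotProduct, sq]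
  rw [h2, smul_eq_mul] at h
  linarith

open Classical in
theorem exists_energy_eq_qMin_mul [Nonempty V] (G : SimpleGraph V) :
    ∃ x : V → ℝ, x ≠ 0 ∧ G.energy x = G.qMin * ∑ v, x v ^ 2 := by
  have h := G.qMin_isLeast.1
  rw [← Matrix.spectrum_toLin', ← Module.End.hasEigenvalue_iff_mem_spectrum] at h
  obtain ⟨x, hx⟩ := h.exists_hasEigenvector
  refine ⟨x, hx.2, ?_⟩
  have h1 : G.signlessLaplacian.mulVec x = G.qMin • x := by
    rw [← Matrix.toLin'_apply]; exact hx.apply_eq_smul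
  rw [energy, h1, dotProduct_smul, smul_eq_mul]
  simp [dotProduct, sq]

open Classical in
theorem Iso.qMin_eq {W : Type*} [Fintype W] {G : SimpleGraph V} {H : SimpleGraph W}
    (e : G ≃g H) : G.qMin = H.qMin := by
  have h : H.signlessLaplacian = Matrix.reindexAlgEquiv ℝ ℝ e.toEquiv G.signlessLaplacian := by
    ext i j
    obtain ⟨a, rfl⟩ := e.toEquiv.surjective i
    obtain ⟨b, rfl⟩ := e.toEquiv.surjective j
    have hd : H.degree (e a) = G.degree a := e.degree_eq a
    have ha : H.Adj (e a) (e b) ↔ G.Adj a b := e.map_adj_iff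
    rw [Matrix.coe_reindexAlgEquiv, Matrix.reindex_apply, Matrix.submatrix_apply,
      Equiv.symm_apply_apply, Equiv.symm_apply_apply]
    simp [signlessLaplacian, degMatrix, Matrix.diagonal_apply, adjMatrix_apply, hd, ha]
  rw [qMin, qMin, h, AlgEquiv.spectrum_eq]

end SimpleGraph

/-! ### Cycles with a hanging forest -/

namespace SimpleGraph

variable {V : Type*}

/-- A cycle of length `g` in `G`, given by an injective map from `ZMod g`, together with a forest
hung onto it: every vertex `v` has a depth, which vanishes exactly on the cycle, and every vertex
off the cycle is adjacent to its parent, whose depth is smaller by one. (The parent of a cycle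
vertex is irrelevant.) -/
structure RootedCycle (G : SimpleGraph V) (g : ℕ) where
  cyc : ZMod g → V
  cyc_injective : Function.Injective cyc
  cyc_adj : ∀ i, G.Adj (cyc i) (cyc (i + 1))
  depth : V → ℕ
  depth_eq_zero : ∀ v, depth v = 0 ↔ ∃ i, cyc i = v
  parent : V → V
  parent_adj : ∀ v, depth v ≠ 0 → G.Adj v (parent v)
  depth_parent : ∀ v, depth v ≠ 0 → depth (parent v) + 1 = depth v

namespace RootedCycle

variable {G : SimpleGraph V} {g : ℕ} (R : G.RootedCycle g)

/-- The oriented edges of the unicyclic spanning subgraph formed by the cycle and the forest. -/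
def Arc (u v : V) : Prop :=
  (∃ i, R.cyc i = u ∧ R.cyc (i + 1) = v) ∨ (R.depth u ≠ 0 ∧ R.parent u = v)

theorem depth_cyc (i : ZMod g) : R.depth (R.cyc i) = 0 := (R.depth_eq_zero _).2 ⟨i, rfl⟩

theorem Arc.adj {u v : V} (h : R.Arc u v) : G.Adj u v := by
  rcases h with ⟨i, rfl, rfl⟩ | ⟨h, rfl⟩
  · exact R.cyc_adj i
  · exact R.parent_adj u h

theorem Arc.not_swap (hg : 3 ≤ g) {u v : V} (h : R.Arc u v) : ¬ R.Arc v u := by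
  have h2 : (1 : ZMod g) + 1 ≠ 0 := by
    intro h
    have h' : ((2 : ℕ) : ZMod g) = 0 := by push_cast; rw [← one_add_one_eq_two]; exact h
    rw [ZMod.natCast_eq_zero_iff] at h'
    exact absurd (Nat.le_of_dvd (by norm_num) h') (by omega)
  rcases h with ⟨i, rfl, rfl⟩ | ⟨h, rfl⟩
  · rintro (⟨j, hj, hj'⟩ | ⟨hj, -⟩)
    · have e1 := R.cyc_injective hj
      have e2 := R.cyc_injective hj'
      apply h2
      rw [e1, add_assoc] at e2
      simpa using e2
    · exact hj (R.depth_cyc _)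
  · rintro (⟨j, hj, hj'⟩ | ⟨hj, hj'⟩)
    · apply h; rw [← hj']; exact R.depth_cyc _
    · have e1 := R.depth_parent u h
      have e2 := R.depth_parent _ hj
      rw [hj'] at e2
      omega

variable [Fintype V]

/-- The edges outside of the cycle and the forest contribute `R.excess x` to twice the energy. -/
noncomputable def excess (x : V → ℝ) : ℝ := by
  classical
  exact ∑ p : V × V with G.Adj p.1 p.2 ∧ ¬ (R.Arc p.1 p.2 ∨ R.Arc p.2 p.1), (x p.1 + x p.2) ^ 2

theorem excess_nonneg (x : V → ℝ) : 0 ≤ R.excess x := by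
  classical
  exact Finset.sum_nonneg fun _ _ => sq_nonneg _

theorem arc_of_excess_eq_zero {x : V → ℝ} (h : R.excess x = 0) {u v : V} (huv : G.Adj u v)
    (hx : x u + x v ≠ 0) : R.Arc u v ∨ R.Arc v u := by
  classical
  by_contra hcon
  rw [excess, Finset.sum_eq_zero_iff_of_nonneg fun _ _ => sq_nonneg _] at h
  have := h (u, v) (by simpa using ⟨huv, not_or.1 hcon⟩)
  exact hx (pow_eq_zero_iff (two_ne_zero) |>.1 this)

theorem excess_eq_zero (h : ∀ u v, G.Adj u v → R.Arc u v ∨ R.Arc v u) (x : V → ℝ) :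
    R.excess x = 0 := by
  classical
  rw [excess]
  apply Finset.sum_eq_zero
  intro p hp
  simp only [Finset.mem_filter, Finset.mem_univ, true_and] at hp
  exact absurd (h _ _ hp.1) hp.2

open Classical in
theorem energy_eq (hg : 3 ≤ g) [NeZero g] (x : V → ℝ) :
    G.energy x = ∑ i : ZMod g, (x (R.cyc i) + x (R.cyc (i + 1))) ^ 2 +
      ∑ v with R.depth v ≠ 0, (x v + x (R.parent v)) ^ 2 + R.excess x / 2 := by
  have h1 : 2 * G.energy x = ∑ p : V × V with G.Adj p.1 p.2, (x p.1 + x p.2) ^ 2 := by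
    rw [energy_eq_sum, Finset.sum_filter, ← Finset.univ_product_univ, Finset.sum_product]
  have hswap : ∑ p : V × V with R.Arc p.2 p.1, (x p.1 + x p.2) ^ 2 =
      ∑ p : V × V with R.Arc p.1 p.2, (x p.1 + x p.2) ^ 2 := by
    refine Finset.sum_nbij' Prod.swap Prod.swap ?_ ?_ ?_ ?_ ?_ <;> simp [add_comm]
  have h2 : ∑ p : V × V with G.Adj p.1 p.2, (x p.1 + x p.2) ^ 2 =
      2 * ∑ p : V × V with R.Arc p.1 p.2, (x p.1 + x p.2) ^ 2 + R.excess x := by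
    rw [← Finset.sum_filter_add_sum_filter_not (Finset.univ.filter fun p : V × V => G.Adj p.1 p.2)
      (fun p => R.Arc p.1 p.2 ∨ R.Arc p.2 p.1), Finset.filter_filter, Finset.filter_filter, excess]
    congr 1
    rw [two_mul]
    nth_rw 2 [← hswap]
    rw [← Finset.sum_union]
    · refine Finset.sum_congr ?_ fun _ _ => rfl
      ext p
      simp only [Finset.mem_filter, Finset.mem_univ, true_and, Finset.mem_union]
      constructor
      · exact fun h => h.2
      · rintro (h | h)
        · exact ⟨h.adj, Or.inl h⟩
        · exact ⟨h.adj.symm, Or.inr h⟩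
    · rw [Finset.disjoint_filter]
      exact fun p _ h => h.not_swap R hg
  have h3 : ∑ p : V × V with R.Arc p.1 p.2, (x p.1 + x p.2) ^ 2 =
      ∑ i : ZMod g, (x (R.cyc i) + x (R.cyc (i + 1))) ^ 2 +
      ∑ v with R.depth v ≠ 0, (x v + x (R.parent v)) ^ 2 := by
    have e1 : ∑ i : ZMod g, (x (R.cyc i) + x (R.cyc (i + 1))) ^ 2 =
        ∑ p ∈ Finset.univ.image (fun i : ZMod g => (R.cyc i, R.cyc (i + 1))),
          (x p.1 + x p.2) ^ 2 := by
      rw [Finset.sum_image]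
      intro i _ j _ h
      exact R.cyc_injective (Prod.ext_iff.1 h).1
    have e2 : ∑ v with R.depth v ≠ 0, (x v + x (R.parent v)) ^ 2 =
        ∑ p ∈ (Finset.univ.filter fun v => R.depth v ≠ 0).image (fun v => (v, R.parent v)),
          (x p.1 + x p.2) ^ 2 := by
      rw [Finset.sum_image]
      intro i _ j _ h
      exact (Prod.ext_iff.1 h).1
    rw [e1, e2, ← Finset.sum_union]
    · refine Finset.sum_congr ?_ fun _ _ => rfl
      ext ⟨u, v⟩
      rw [Finset.mem_filter, Finset.mem_union]
      simp [Arc]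
    · rw [Finset.disjoint_left]
      simp only [Finset.mem_image, Finset.mem_univ, true_and, Finset.mem_filter]
      rintro _ ⟨i, rfl⟩ ⟨v, hv, he⟩
      have hvi : v = R.cyc i := (Prod.ext_iff.1 he).1
      exact hv (hvi ▸ R.depth_cyc i)
  linarith

open Classical in
theorem sum_eq_sum_cyc_add [NeZero g] (f : V → ℝ) :
    ∑ v, f v = ∑ i : ZMod g, f (R.cyc i) + ∑ v with R.depth v ≠ 0, f v := by
  rw [← Finset.sum_filter_add_sum_filter_not Finset.univ (fun v => R.depth v = 0)]
  congr 1
  rw [← Finset.sum_image (f := f) (g := R.cyc) (s := Finset.univ)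
    (fun i _ j _ h => R.cyc_injective h)]
  refine Finset.sum_congr ?_ fun _ _ => rfl
  ext v
  simp [R.depth_eq_zero]

end RootedCycle

/-! ### The quadratic forms on the cycle and on the path -/

/-- The contribution of a cycle carrying the values `c` to the form `xᵀ (Q - q) x`. -/
noncomputable def cycForm {g : ℕ} [NeZero g] (q : ℝ) (c : ZMod g → ℝ) : ℝ :=
  ∑ i, ((c i + c (i + 1)) ^ 2 - q * c i ^ 2)

/-- The contribution to the form `xᵀ (Q - q) x` of a path with values `b 0, …, b d`, apart from
the diagonal term of its first vertex. -/
noncomputable def pathForm (q : ℝ) (b : ℕ → ℝ) (d : ℕ) : ℝ :=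
  ∑ i ∈ Finset.range d, ((b (i + 1) + b i) ^ 2 - q * b (i + 1) ^ 2)

theorem RootedCycle.energy_sub_eq {V : Type*} [Fintype V] {G : SimpleGraph V} {g : ℕ} [NeZero g]
    (R : G.RootedCycle g) (hg : 3 ≤ g) (q : ℝ)
    (x : V → ℝ) :
    G.energy x - q * ∑ v, x v ^ 2 = cycForm q (fun i => x (R.cyc i)) +
      ∑ v with R.depth v ≠ 0, ((x v + x (R.parent v)) ^ 2 - q * x v ^ 2) + R.excess x / 2 := by
  classical
  rw [R.energy_eq hg, R.sum_eq_sum_cyc_add, cycForm]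
  simp only [Finset.sum_sub_distrib, mul_add, Finset.mul_sum]
  ring

/-- The form of a rooted odd cycle is positive definite: a kernel vector changes its sign along
every edge, hence vanishes on the odd cycle and then everywhere. -/
theorem RootedCycle.eq_zero_of_energy_eq_zero {V : Type*} [Fintype V] {G : SimpleGraph V} {g : ℕ}
    (R : G.RootedCycle g) (hg : Odd g) {x : V → ℝ} (h : G.energy x = 0) : x = 0 := by
  classical
  have hadj : ∀ u v, G.Adj u v → x v = - x u := by
    intro u v huv
    have h2 := G.energy_eq_sum x
    rw [h, mul_zero, eq_comm, Finset.sum_eq_zero_iff_of_nonneg (fun _ _ => by positivity)] at h2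
    have h3 := h2 u (Finset.mem_univ _)
    rw [Finset.sum_eq_zero_iff_of_nonneg (fun _ _ => by positivity)] at h3
    have h4 := h3 v (Finset.mem_univ _)
    rw [if_pos huv, pow_eq_zero_iff two_ne_zero] at h4
    linarith
  have hc : ∀ i, x (R.cyc i) = 0 := by
    intro i
    have hk : ∀ k : ℕ, x (R.cyc (i + k)) = (-1) ^ k * x (R.cyc i) := by
      intro k
      induction k with
      | zero => simp
      | succ k ih =>
        have := hadj _ _ (R.cyc_adj (i + k))
        rw [Nat.cast_succ, ← add_assoc, this, ih, pow_succ]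
        ring
    have := hk g
    rw [ZMod.natCast_self, add_zero, hg.neg_one_pow] at this
    linarith
  have hd : ∀ d v, R.depth v = d → x v = 0 := by
    intro d
    induction d with
    | zero =>
      intro v hv
      obtain ⟨i, rfl⟩ := (R.depth_eq_zero v).1 hv
      exact hc i
    | succ d ih =>
      intro v hv
      have h1 := R.parent_adj v (by omega)
      have h2 := R.depth_parent v (by omega)
      have := hadj _ _ h1.symm
      rw [this, ih _ (by omega), neg_zero]
  funext v
  exact hd _ v rfl

end SimpleGraph

namespace SimpleGraph

/-! ### Extending the path of the extremal graph -/

section Forms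

variable {g : ℕ} [NeZero g] {q : ℝ}

theorem cycForm_rotate (q : ℝ) (c : ZMod g → ℝ) (s : ZMod g) :
    cycForm q (fun i => c (i + s)) = cycForm q c := by
  rw [cycForm, cycForm]
  conv_rhs => rw [← Equiv.sum_comp (Equiv.addRight s)]
  simp [add_right_comm]

/-- On lines, `cycForm` is a quadratic polynomial. -/
theorem exists_cycForm_add_smul (q : ℝ) (c e : ZMod g → ℝ) :
    ∃ B N : ℝ, ∀ t : ℝ, cycForm q (c + t • e) = cycForm q c + t * B + t ^ 2 * N := by
  refine ⟨∑ i, (2 * ((c i + c (i + 1)) * (e i + e (i + 1))) - 2 * q * (c i * e i)),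
    cycForm q e, fun t => ?_⟩
  simp only [cycForm, Finset.mul_sum, ← Finset.sum_add_distrib]
  refine Finset.sum_congr rfl fun i _ => ?_
  simp only [Pi.add_apply, Pi.smul_apply, smul_eq_mul]
  ring

theorem eq_zero_of_forall_linear_add_quadratic_nonneg {B N : ℝ}
    (h : ∀ t : ℝ, 0 ≤ t * B + t ^ 2 * N) : B = 0 := by
  -- at `t = -B / (|N| + 1)` the linear term dominates
  have hN : 0 < |N| + 1 := by positivity
  have h1 := h (-B / (|N| + 1))
  have h2 : -B / (|N| + 1) * B + (-B / (|N| + 1)) ^ 2 * N =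
      B ^ 2 / (|N| + 1) ^ 2 * (N - (|N| + 1)) := by
    field_simp
    ring
  rw [h2] at h1
  have h3 : N - (|N| + 1) < 0 := by linarith [le_abs_self N]
  by_contra hB
  have : 0 < B ^ 2 / (|N| + 1) ^ 2 := by positivity
  nlinarith

theorem pathForm_congr {b b' : ℕ → ℝ} {d : ℕ} (h : ∀ i ≤ d, b i = b' i) :
    pathForm q b d = pathForm q b' d := by
  refine Finset.sum_congr rfl fun i hi => ?_
  have := Finset.mem_range.1 hi
  rw [h i (by omega), h (i + 1) (by omega)]

variable (g q) in
/-- The form `xᵀ (Q - q) x` of a cycle of length `g` with a path of length `m` that ends in the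
centre of a star with `k` leaves is nonnegative. The leaves are eliminated: a leaf next to a vertex
with value `a` contributes at least `-q / (1 - q) * a ^ 2`, with equality for the leaf value
`-a / (1 - q)`. -/
def TailNonneg (m k : ℕ) : Prop :=
  ∀ (r : ZMod g) (c : ZMod g → ℝ) (b : ℕ → ℝ), c r = b 0 →
    0 ≤ cycForm q c + pathForm q b m - k * (q / (1 - q)) * b m ^ 2

/-- Shortening the path increases the form: a shorter path is extended by the values
`-a / (1 - q), a / (1 - q) ^ 2, …`, so that each new vertex contributes as much as a leaf, and
the leaves at the end contribute less than before. -/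
theorem TailNonneg.shorten (hq0 : 0 < q) (hq1 : q < 1) {m k : ℕ} (h : TailNonneg g q m k)
    (j : ℕ) : ∀ d, d + j = m → ∀ (r : ZMod g) (c : ZMod g → ℝ) (b : ℕ → ℝ), c r = b 0 →
      0 ≤ cycForm q c + pathForm q b d - (k + j) * (q / (1 - q)) * b d ^ 2 ∧
      (1 ≤ j → 1 ≤ k → b d ≠ 0 →
        0 < cycForm q c + pathForm q b d - (k + j) * (q / (1 - q)) * b d ^ 2) := by
  have hp : 0 < 1 - q := by linarith
  induction j with
  | zero =>
    intro d hd r c b hb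
    obtain rfl : d = m := by omega
    simpa using h r c b hb
  | succ j ih =>
    intro d hd r c b hb
    set b' : ℕ → ℝ := fun i => if i ≤ d then b i else - b d / (1 - q) with hb'
    have h0 : b' 0 = b 0 := by simp [hb']
    have hd1 : b' (d + 1) = - b d / (1 - q) := by simp [hb']
    have hd2 : b' d = b d := by simp [hb']
    have h1 := (ih (d + 1) (by omega) r c b' (by rw [hb, h0])).1
    have h2 : pathForm q b' (d + 1) = pathForm q b d - q / (1 - q) * b d ^ 2 := by
      rw [pathForm, Finset.sum_range_succ, ← pathForm, hd1, hd2,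
        pathForm_congr (b := b') (b' := b) fun i hi => by simp [hb', hi]]
      field_simp
      ring
    rw [h2, hd1] at h1
    have h3 : (- b d / (1 - q)) ^ 2 = b d ^ 2 + b d ^ 2 * (q * (2 - q) / (1 - q) ^ 2) := by
      field_simp
      ring
    rw [h3] at h1
    have h4 : 0 < q * (2 - q) / (1 - q) ^ 2 := by
      have : 0 < 2 - q := by linarith
      positivity
    have h5 : 0 < q / (1 - q) := by positivity
    have h6 : 0 ≤ (k + j : ℝ) * (q / (1 - q)) * (b d ^ 2 * (q * (2 - q) / (1 - q) ^ 2)) := by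
      positivity
    push_cast
    constructor
    · linarith
    · intro _ hk hbd
      have hk' : (1 : ℝ) ≤ k := by exact_mod_cast hk
      have : 0 < (k + j : ℝ) * (q / (1 - q)) * (b d ^ 2 * (q * (2 - q) / (1 - q) ^ 2)) := by
        have : (0 : ℝ) < k + j := by positivity
        positivity
      linarith

end Forms

/-! ### The lower bound for rooted cycles of bounded depth -/

namespace RootedCycle

variable {V : Type*} {G : SimpleGraph V} {g : ℕ} (R : G.RootedCycle g)

/-- The ancestor of depth `i` of a vertex `u`, for `i ≤ R.depth u`. -/
def ancestor (u : V) (i : ℕ) : V := R.parent^[R.depth u - i] u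

theorem ancestor_depth (u : V) : R.ancestor u (R.depth u) = u := by simp [ancestor]

theorem parent_ancestor (u : V) {i : ℕ} (hi : i < R.depth u) :
    R.parent (R.ancestor u (i + 1)) = R.ancestor u i := by
  rw [ancestor, ancestor, ← Function.iterate_succ_apply' R.parent]
  congr 2
  omega

theorem depth_ancestor (u : V) {i : ℕ} (hi : i ≤ R.depth u) : R.depth (R.ancestor u i) = i := by
  induction hj : R.depth u - i generalizing i with
  | zero =>
    obtain rfl : i = R.depth u := by omega
    rw [ancestor_depth]
  | succ j ih =>
    have h1 := ih (i := i + 1) (by omega) (by omega)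
    have h2 := R.depth_parent (R.ancestor u (i + 1)) (by omega)
    rw [R.parent_ancestor u (by omega)] at h2
    omega

variable [Fintype V] [NeZero g]

theorem card_eq : Fintype.card V = g + (Finset.univ.filter fun v => R.depth v ≠ 0).card := by
  have h := R.sum_eq_sum_cyc_add (fun _ => (1 : ℝ))
  simp only [Finset.sum_const, nsmul_eq_mul, mul_one, Finset.card_univ, ZMod.card] at h
  exact_mod_cast h

theorem add_depth_le_card (u : V) : g + R.depth u ≤ Fintype.card V := by
  classical
  rw [R.card_eq]
  have : (Finset.Icc 1 (R.depth u)).card ≤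
      (Finset.univ.filter fun v => R.depth v ≠ 0).card := by
    refine Finset.card_le_card_of_injOn (R.ancestor u) ?_ ?_
    · intro i hi
      rw [Finset.mem_coe, Finset.mem_Icc] at hi
      simp only [Finset.coe_filter, Finset.mem_univ, true_and, Set.mem_ofPred_eq]
      rw [R.depth_ancestor u hi.2]
      omega
    · intro i hi j hj hij
      rw [Finset.mem_coe, Finset.mem_Icc] at hi hj
      rw [← R.depth_ancestor u hi.2, hij, R.depth_ancestor u hj.2]
  rw [Nat.card_Icc] at this
  omega

open Classical in
/-- The vertices off the cycle which do not lie on the path from the cycle to `u` either. -/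
noncomputable def offPath (u : V) : Finset V :=
  Finset.univ.filter fun v =>
    R.depth v ≠ 0 ∧ ¬ (R.depth v ≤ R.depth u ∧ v = R.ancestor u (R.depth v))

open Classical in
omit [NeZero g] in
theorem sum_depth_ne_zero (u : V) (f : V → ℝ) : ∑ v with R.depth v ≠ 0, f v =
    ∑ i ∈ Finset.range (R.depth u), f (R.ancestor u (i + 1)) + ∑ v ∈ R.offPath u, f v := by
  rw [← Finset.sum_filter_add_sum_filter_not (Finset.univ.filter fun v => R.depth v ≠ 0)
    (fun v => R.depth v ≤ R.depth u ∧ v = R.ancestor u (R.depth v)), Finset.filter_filter,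
    Finset.filter_filter, offPath]
  congr 1
  rw [← Finset.sum_image (f := f) (g := fun i => R.ancestor u (i + 1))]
  · refine Finset.sum_congr ?_ fun _ _ => rfl
    ext v
    simp only [Finset.mem_filter, Finset.mem_univ, true_and, Finset.mem_image, Finset.mem_range]
    constructor
    · rintro ⟨h0, h1, h2⟩
      exact ⟨R.depth v - 1, by omega, by rw [Nat.sub_add_cancel (by omega)]; exact h2.symm⟩
    · rintro ⟨i, hi, rfl⟩
      rw [R.depth_ancestor u (by omega)]
      exact ⟨by omega, by omega, rfl⟩
  · intro i hi j hj hij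
    simp only [Finset.coe_range, Set.mem_Iio] at hi hj
    have h1 := R.depth_ancestor u (i := i + 1) (by omega)
    have h2 := R.depth_ancestor u (i := j + 1) (by omega)
    simp only at hij
    rw [hij] at h1
    omega

theorem card_offPath (u : V) : g + R.depth u + (R.offPath u).card = Fintype.card V := by
  have h := R.sum_depth_ne_zero u (fun _ => (1 : ℝ))
  simp only [Finset.sum_const, nsmul_eq_mul, mul_one, Finset.card_range] at h
  have h' : (Finset.univ.filter fun v => R.depth v ≠ 0).card
    = R.depth u + (R.offPath u).card := by exact_mod_cast h
  rw [R.card_eq, h']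
  ring

/-- The form `xᵀ (Q - q) x` splits into the form of the cycle with the path to `u`, where all
vertices off the path are turned into leaves at `u`, and the error made by this, vertex by
vertex. -/
theorem energy_sub_eq_tail_add (hg : 3 ≤ g) (q κ : ℝ) (x : V → ℝ) (u : V) :
    G.energy x - q * ∑ v, x v ^ 2 =
      (cycForm q (fun i => x (R.cyc i)) + pathForm q (fun i => x (R.ancestor u i)) (R.depth u)
        - (R.offPath u).card * κ * x u ^ 2) +
      ∑ v ∈ R.offPath u, ((x v + x (R.parent v)) ^ 2 - q * x v ^ 2 + κ * x u ^ 2) +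
      R.excess x / 2 := by
  rw [R.energy_sub_eq hg, R.sum_depth_ne_zero u, Finset.sum_add_distrib, Finset.sum_const,
    nsmul_eq_mul, pathForm]
  have : ∀ i ∈ Finset.range (R.depth u), (x (R.ancestor u (i + 1)) +
      x (R.parent (R.ancestor u (i + 1)))) ^ 2 - q * x (R.ancestor u (i + 1)) ^ 2 =
      (x (R.ancestor u (i + 1)) + x (R.ancestor u i)) ^ 2 - q * x (R.ancestor u (i + 1)) ^ 2 := by
    intro i hi
    rw [R.parent_ancestor u (Finset.mem_range.1 hi)]
  rw [Finset.sum_congr rfl this]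
  ring

omit [Fintype V] [NeZero g] in
theorem exists_cyc_eq_ancestor_zero (u : V) : ∃ r, R.cyc r = R.ancestor u 0 :=
  (R.depth_eq_zero _).1 (R.depth_ancestor u (Nat.zero_le _))

section Bound

variable {q : ℝ} {m k : ℕ} {x : V → ℝ} {u : V}

omit [Fintype V] [NeZero g] in
/-- A vertex off the path costs no less than a leaf at `u`, if the absolute value of `x` is
maximal at `u` among all vertices that are not of the greatest possible depth. -/
theorem leaf_error_nonneg (hq0 : 0 < q) (hq1 : q < 1) (hdepth : ∀ v, R.depth v ≤ m + 1)
    (hu : ∀ v, R.depth v ≤ m → x v ^ 2 ≤ x u ^ 2) {v : V} (hv : R.depth v ≠ 0) :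
    0 ≤ (x v + x (R.parent v)) ^ 2 - q * x v ^ 2 + q / (1 - q) * x u ^ 2 ∧
    ((x v + x (R.parent v)) ^ 2 - q * x v ^ 2 + q / (1 - q) * x u ^ 2 = 0 →
      (x u ≠ 0 → R.depth v = m + 1 ∧ x (R.parent v) ^ 2 = x u ^ 2) ∧
      x v = - x (R.parent v) / (1 - q)) := by
  have hp : 0 < 1 - q := by linarith
  have hpar : x (R.parent v) ^ 2 ≤ x u ^ 2 := by
    apply hu
    have := R.depth_parent v hv
    have := hdepth v
    omega
  have hκ : 0 < q / (1 - q) := by positivity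
  have hid : (x v + x (R.parent v)) ^ 2 - q * x v ^ 2 + q / (1 - q) * x u ^ 2 =
      (1 - q) * (x v - - x (R.parent v) / (1 - q)) ^ 2 +
        q / (1 - q) * (x u ^ 2 - x (R.parent v) ^ 2) := by
    field_simp
    ring
  have h1 : 0 ≤ (1 - q) * (x v - - x (R.parent v) / (1 - q)) ^ 2 := by positivity
  have h2 : 0 ≤ q / (1 - q) * (x u ^ 2 - x (R.parent v) ^ 2) :=
    mul_nonneg hκ.le (by linarith)
  refine ⟨by rw [hid]; linarith, fun h0 => ?_⟩
  have h0' := hid ▸ h0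
  have h3 : (x v - - x (R.parent v) / (1 - q)) ^ 2 = 0 := by
    rcases mul_eq_zero.1 (by linarith : (1 - q) * (x v - - x (R.parent v) / (1 - q)) ^ 2 = 0)
      with h | h
    · linarith
    · exact h
  have h4 : x u ^ 2 - x (R.parent v) ^ 2 = 0 := by
    rcases mul_eq_zero.1 (by linarith : q / (1 - q) * (x u ^ 2 - x (R.parent v) ^ 2) = 0)
      with h | h
    · linarith
    · exact h
  refine ⟨fun hxu => ⟨?_, by linarith⟩, by
    rw [pow_eq_zero_iff two_ne_zero] at h3; linarith⟩
  by_contra hne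
  have hle : x v ^ 2 ≤ x u ^ 2 := hu v (by have := hdepth v; omega)
  have hxu2 : 0 < x u ^ 2 := by positivity
  -- `q < q / (1 - q)` makes the error of a vertex of depth at most `m` positive
  have h5 : q / (1 - q) * x u ^ 2 = q * x u ^ 2 + q ^ 2 / (1 - q) * x u ^ 2 := by
    field_simp
    ring
  have h6 : 0 < q ^ 2 / (1 - q) * x u ^ 2 := by positivity
  nlinarith [sq_nonneg (x v + x (R.parent v))]

omit [NeZero g] in
theorem exists_max_of_depth_le (m : ℕ) (x : V → ℝ) :
    ∃ u, R.depth u ≤ m ∧ ∀ v, R.depth v ≤ m → x v ^ 2 ≤ x u ^ 2 := by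
  classical
  obtain ⟨u, hu, hmax⟩ := Finset.exists_max_image (Finset.univ.filter fun v => R.depth v ≤ m)
    (fun v => x v ^ 2) ⟨R.cyc 0, by simp [R.depth_cyc]⟩
  simp only [Finset.mem_filter, Finset.mem_univ, true_and] at hu hmax
  exact ⟨u, hu, hmax⟩

theorem tail_nonneg (hq0 : 0 < q) (hq1 : q < 1) (htail : TailNonneg g q m k)
    (hcard : Fintype.card V = g + m + k) (hum : R.depth u ≤ m) (x : V → ℝ) :
    0 ≤ cycForm q (fun i => x (R.cyc i)) + pathForm q (fun i => x (R.ancestor u i)) (R.depth u)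
        - (R.offPath u).card * (q / (1 - q)) * x u ^ 2 ∧
    (R.depth u < m → 1 ≤ k → x u ≠ 0 →
      0 < cycForm q (fun i => x (R.cyc i)) + pathForm q (fun i => x (R.ancestor u i)) (R.depth u)
        - (R.offPath u).card * (q / (1 - q)) * x u ^ 2) := by
  obtain ⟨r, hr⟩ := R.exists_cyc_eq_ancestor_zero u
  have h := htail.shorten hq0 hq1 (m - R.depth u) (R.depth u) (by omega) r
    (fun i => x (R.cyc i)) (fun i => x (R.ancestor u i)) (by simp only [hr])
  have hc : ((R.offPath u).card : ℝ) = k + (m - R.depth u : ℕ) := by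
    have := R.card_offPath u
    rw [hcard] at this
    exact_mod_cast (by omega : (R.offPath u).card = k + (m - R.depth u))
  rw [hc]
  simp only [R.ancestor_depth] at h
  exact ⟨h.1, fun h1 h2 h3 => h.2 (by omega) h2 h3⟩

/-- The lower bound `q ≤ q_min(G)`, in terms of the quadratic form. -/
theorem le_energy (hg : 3 ≤ g) (hq0 : 0 < q) (hq1 : q < 1) (htail : TailNonneg g q m k)
    (hcard : Fintype.card V = g + m + k) (hdepth : ∀ v, R.depth v ≤ m + 1) (x : V → ℝ) :
    q * ∑ v, x v ^ 2 ≤ G.energy x := by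
  obtain ⟨u, hum, hu⟩ := R.exists_max_of_depth_le m x
  have h1 := R.energy_sub_eq_tail_add hg q (q / (1 - q)) x u
  have h2 := (R.tail_nonneg hq0 hq1 htail hcard hum x).1
  have h3 := R.excess_nonneg x
  have h4 : 0 ≤ ∑ v ∈ R.offPath u,
      ((x v + x (R.parent v)) ^ 2 - q * x v ^ 2 + q / (1 - q) * x u ^ 2) := by
    refine Finset.sum_nonneg fun v hv => ?_
    simp only [offPath, Finset.mem_filter, Finset.mem_univ, true_and] at hv
    exact (R.leaf_error_nonneg hq0 hq1 hdepth hu hv.1).1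
  linarith

/-- What equality in the lower bound says about a vector `x` on which it is attained. -/
theorem tight_of_energy_eq (hg : 3 ≤ g) (hq0 : 0 < q) (hq1 : q < 1)
    (htail : TailNonneg g q m k) (hk : 1 ≤ k) (hcard : Fintype.card V = g + m + k)
    (hdepth : ∀ v, R.depth v ≤ m + 1) (hx : x ≠ 0) (heq : G.energy x = q * ∑ v, x v ^ 2) :
    ∃ u, R.depth u = m ∧ x u ≠ 0 ∧ (∀ v, R.depth v ≤ m → x v ^ 2 ≤ x u ^ 2) ∧
      (∀ v, R.depth v ≠ 0 → R.depth v ≤ m → v = R.ancestor u (R.depth v)) ∧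
      (∀ v, R.depth v = m + 1 → x v = - x (R.parent v) / (1 - q) ∧
        x (R.parent v) ^ 2 = x u ^ 2) ∧
      R.excess x = 0 ∧
      cycForm q (fun i => x (R.cyc i)) + pathForm q (fun i => x (R.ancestor u i)) m
        - k * (q / (1 - q)) * x u ^ 2 = 0 := by
  obtain ⟨u, hum, hu⟩ := R.exists_max_of_depth_le m x
  have h1 := R.energy_sub_eq_tail_add hg q (q / (1 - q)) x u
  have h2 := R.tail_nonneg hq0 hq1 htail hcard hum x
  have h3 := R.excess_nonneg x
  have hmem : ∀ v ∈ R.offPath u, R.depth v ≠ 0 := by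
    intro v hv
    simp only [offPath, Finset.mem_filter, Finset.mem_univ, true_and] at hv
    exact hv.1
  have h4 : ∀ v ∈ R.offPath u,
      0 ≤ (x v + x (R.parent v)) ^ 2 - q * x v ^ 2 + q / (1 - q) * x u ^ 2 :=
    fun v hv => (R.leaf_error_nonneg hq0 hq1 hdepth hu (hmem v hv)).1
  have h5 := Finset.sum_nonneg h4
  have h6 := (Finset.sum_eq_zero_iff_of_nonneg h4).1 (by linarith [h2.1])
  have h7 : ∀ v ∈ R.offPath u, _ :=
    fun v hv => (R.leaf_error_nonneg hq0 hq1 hdepth hu (hmem v hv)).2 (h6 v hv)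
  have hxu : x u ≠ 0 := by
    intro h0
    apply hx
    have hsmall : ∀ v, R.depth v ≤ m → x v = 0 := by
      intro v hv
      have := hu v hv
      rw [h0] at this
      exact pow_eq_zero_iff two_ne_zero |>.1 (le_antisymm (by simpa using this) (sq_nonneg _))
    funext v
    by_cases hv : R.depth v ≤ m
    · exact hsmall v hv
    · have hoff : v ∈ R.offPath u := by
        simp only [offPath, Finset.mem_filter, Finset.mem_univ, true_and]
        exact ⟨by omega, fun h => by omega⟩
      rw [(h7 v hoff).2, hsmall (R.parent v)]
      · simp
      · have := R.depth_parent v (by omega)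
        have := hdepth v
        omega
  have hudepth : R.depth u = m := by
    by_contra hne
    have := h2.2 (by omega) hk hxu
    linarith
  refine ⟨u, hudepth, hxu, hu, ?_, ?_, ?_, ?_⟩
  · intro v hv0 hvm
    by_contra hne
    have hoff : v ∈ R.offPath u := by
      simp only [offPath, Finset.mem_filter, Finset.mem_univ, true_and]
      exact ⟨hv0, fun h => hne h.2⟩
    have := ((h7 v hoff).1 hxu).1
    omega
  · intro v hv
    have hoff : v ∈ R.offPath u := by
      simp only [offPath, Finset.mem_filter, Finset.mem_univ, true_and]
      exact ⟨by omega, fun h => by omega⟩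
    exact ⟨(h7 v hoff).2, ((h7 v hoff).1 hxu).2⟩
  · linarith [h2.1]
  · have hc : (R.offPath u).card = k := by
      have := R.card_offPath u
      omega
    rw [← hudepth, ← hc]
    linarith [h2.1]

end Bound

end RootedCycle

end SimpleGraph

namespace SimpleGraph

namespace RootedCycle

/-! ### Brooms hung onto a cycle -/

variable {V : Type*} {G : SimpleGraph V} {g : ℕ} (R : G.RootedCycle g)

/-- The rooted cycle `R` exhausts the edges of `G`, and its forest is a path of length `m` from
the cycle vertex `R.cyc r` to `u` together with leaves that are attached to `u`. -/
structure IsBroom (m : ℕ) (r : ZMod g) (u : V) : Prop where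
  depth_le : ∀ v, R.depth v ≤ m + 1
  depth_center : R.depth u = m
  root : R.ancestor u 0 = R.cyc r
  eq_ancestor : ∀ v, R.depth v ≠ 0 → R.depth v ≤ m → v = R.ancestor u (R.depth v)
  parent_leaf : ∀ v, R.depth v = m + 1 → R.parent v = u
  arc_of_adj : ∀ v w, G.Adj v w → R.Arc v w ∨ R.Arc w v

variable {R} {m : ℕ} {r : ZMod g} {u : V}

theorem IsBroom.mem_offPath_iff [Fintype V] (h : R.IsBroom m r u) {v : V} :
    v ∈ R.offPath u ↔ R.depth v = m + 1 := by
  simp only [offPath, Finset.mem_filter, Finset.mem_univ, true_and, h.depth_center]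
  constructor
  · rintro ⟨h0, h1⟩
    by_contra hne
    have hle := h.depth_le v
    exact h1 ⟨by omega, h.eq_ancestor v h0 (by omega)⟩
  · intro hv
    exact ⟨by omega, fun h' => by omega⟩

/-- The order of the graph determines a broom on a cycle up to isomorphism. -/
theorem IsBroom.nonempty_iso [Fintype V] [NeZero g] {V' : Type*} [Fintype V']
    {G' : SimpleGraph V'} {R' : G'.RootedCycle g} {r' : ZMod g} {u' : V'}
    (h : R.IsBroom m r u) (h' : R'.IsBroom m r' u') (hcard : Fintype.card V = Fintype.card V') :
    Nonempty (G ≃g G') := by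
  classical
  have hoff : (R.offPath u).card = (R'.offPath u').card := by
    have h1 := R.card_offPath u
    have h2 := R'.card_offPath u'
    rw [h.depth_center] at h1
    rw [h'.depth_center] at h2
    omega
  let σ := Finset.equivOfCardEq hoff
  choose! idx hidx using fun v => (R.depth_eq_zero v).1
  let f : V → V' := fun v =>
    if R.depth v = 0 then R'.cyc (idx v + (r' - r))
    else if hv : v ∈ R.offPath u then σ ⟨v, hv⟩ else R'.ancestor u' (R.depth v)
  have fcyc : ∀ i, f (R.cyc i) = R'.cyc (i + (r' - r)) := by
    intro i
    have h0 := R.depth_cyc i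
    simp only [f, h0, if_true]
    rw [R.cyc_injective (hidx _ h0)]
  have fleaf : ∀ v, R.depth v = m + 1 → R'.depth (f v) = m + 1 := by
    intro v hv
    have hv' : v ∈ R.offPath u := h.mem_offPath_iff.2 hv
    simp only [f, hv', dif_pos, if_neg (show R.depth v ≠ 0 by omega)]
    exact h'.mem_offPath_iff.1 (σ ⟨v, hv'⟩).2
  have fpath : ∀ i ≤ m, f (R.ancestor u i) = R'.ancestor u' i := by
    intro i hi
    rcases Nat.eq_zero_or_pos i with rfl | hpos
    · rw [h.root, fcyc, h'.root]
      congr 1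
      ring
    · have hd := R.depth_ancestor u (i := i) (by rw [h.depth_center]; exact hi)
      have hv : R.ancestor u i ∉ R.offPath u := by
        rw [h.mem_offPath_iff]; omega
      simp only [f, hv, dif_neg, not_false_eq_true, hd, if_neg (show i ≠ 0 by omega)]
  have fdepth : ∀ v, R'.depth (f v) = R.depth v := by
    intro v
    by_cases h0 : R.depth v = 0
    · obtain ⟨i, rfl⟩ := (R.depth_eq_zero v).1 h0
      rw [fcyc, R'.depth_cyc, R.depth_cyc]
    · by_cases hv : R.depth v = m + 1
      · rw [fleaf v hv, hv]
      · have hle := h.depth_le v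
        conv_lhs => rw [h.eq_ancestor v h0 (by omega)]
        rw [fpath _ (by omega), R'.depth_ancestor u' (by rw [h'.depth_center]; omega)]
  have finj : Function.Injective f := by
    intro v w hvw
    have hd : R.depth v = R.depth w := by rw [← fdepth v, ← fdepth w, hvw]
    by_cases h0 : R.depth v = 0
    · obtain ⟨i, rfl⟩ := (R.depth_eq_zero v).1 h0
      obtain ⟨j, rfl⟩ := (R.depth_eq_zero w).1 (hd ▸ h0)
      rw [fcyc, fcyc] at hvw
      rw [add_right_cancel (R'.cyc_injective hvw)]
    · by_cases hv : R.depth v = m + 1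
      · have hv' : v ∈ R.offPath u := h.mem_offPath_iff.2 hv
        have hw' : w ∈ R.offPath u := h.mem_offPath_iff.2 (hd ▸ hv)
        simp only [f, hv', hw', dif_pos, if_neg h0, if_neg (hd ▸ h0)] at hvw
        simpa using σ.injective (Subtype.ext hvw)
      · have hle := h.depth_le v
        rw [h.eq_ancestor v h0 (by omega), h.eq_ancestor w (by omega) (by omega), hd]
  have fparent : ∀ v, R.depth v ≠ 0 → f (R.parent v) = R'.parent (f v) := by
    intro v h0
    by_cases hv : R.depth v = m + 1
    · rw [h.parent_leaf v hv, h'.parent_leaf _ (fleaf v hv)]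
      have := fpath m le_rfl
      rwa [← h.depth_center, R.ancestor_depth, h.depth_center, ← h'.depth_center,
        R'.ancestor_depth] at this
    · have hle := h.depth_le v
      obtain ⟨d, hd⟩ : ∃ d, R.depth v = d + 1 := ⟨R.depth v - 1, by omega⟩
      rw [h.eq_ancestor v h0 (by omega), hd, R.parent_ancestor u (by rw [h.depth_center]; omega),
        fpath _ (by omega), fpath _ (by omega),
        R'.parent_ancestor u' (by rw [h'.depth_center]; omega)]
  have farc : ∀ v w, R'.Arc (f v) (f w) ↔ R.Arc v w := by
    intro v w
    constructor
    · rintro (⟨i, hi, hi'⟩ | ⟨h0, hp⟩)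
      · obtain ⟨j, rfl⟩ := (R.depth_eq_zero v).1 (by rw [← fdepth, ← hi, R'.depth_cyc])
        rw [fcyc] at hi
        have hij := R'.cyc_injective hi
        refine Or.inl ⟨j, rfl, finj ?_⟩
        rw [← hi', fcyc, hij]
        congr 1
        ring
      · rw [fdepth] at h0
        exact Or.inr ⟨h0, finj (by rw [fparent v h0, hp])⟩
    · rintro (⟨i, rfl, rfl⟩ | ⟨h0, rfl⟩)
      · refine Or.inl ⟨i + (r' - r), (fcyc i).symm, ?_⟩
        rw [fcyc]
        congr 1
        ring
      · exact Or.inr ⟨by rwa [fdepth], (fparent v h0).symm⟩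
  refine ⟨⟨Equiv.ofBijective f ((Fintype.bijective_iff_injective_and_card f).2
    ⟨finj, hcard⟩), ?_⟩⟩
  intro v w
  simp only [Equiv.ofBijective_apply]
  constructor
  · intro hadj
    rcases h'.arc_of_adj _ _ hadj with ha | ha
    · exact ((farc v w).1 ha).adj
    · exact ((farc w v).1 ha).adj.symm
  · intro hadj
    rcases h.arc_of_adj _ _ hadj with ha | ha
    · exact ((farc v w).2 ha).adj
    · exact ((farc w v).2 ha).adj.symm

/-! ### The case of equality in the lower bound -/

/-- If two different cycle vertices could serve as the root of a star, then the vanishing of the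
form would give two contradictory conditions on its derivative in the direction of one of them. -/
theorem _root_.SimpleGraph.TailNonneg.root_unique [NeZero g] {q : ℝ} {k : ℕ} (hq0 : 0 < q)
    (hq1 : q < 1) (hk : 1 ≤ k) (htail : TailNonneg g q 0 k) {c : ZMod g → ℝ} {r s : ZMod g}
    (h0 : cycForm q c - k * (q / (1 - q)) * c r ^ 2 = 0) (hs : c s ^ 2 = c r ^ 2)
    (hr : c r ≠ 0) : s = r := by
  by_contra hsr
  set K : ℝ := k * (q / (1 - q)) with hK
  have hKpos : 0 < K := by
    have : 0 < 1 - q := by linarith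
    have : (0 : ℝ) < k := by exact_mod_cast hk
    positivity
  obtain ⟨B, N, hBN⟩ := exists_cycForm_add_smul q c (Pi.single s 1)
  have hB : B = 0 := by
    apply eq_zero_of_forall_linear_add_quadratic_nonneg (N := N)
    intro t
    have h1 := htail r (c + t • Pi.single s 1) (fun _ => c r)
      (by simp [Pi.single_eq_of_ne (Ne.symm hsr)])
    rw [hBN, pathForm, Finset.sum_range_zero, ← hK] at h1
    linarith
  have hB' : B - 2 * K * c s = 0 := by
    apply eq_zero_of_forall_linear_add_quadratic_nonneg (N := N - K)
    intro t
    have h1 := htail s (c + t • Pi.single s 1) (fun _ => c s + t) (by simp)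
    rw [hBN, pathForm, Finset.sum_range_zero, ← hK] at h1
    have : K * (c s + t) ^ 2 = K * c r ^ 2 + t * (2 * K * c s) + t ^ 2 * K := by
      rw [← hs]; ring
    linarith
  have hcs : c s = 0 := by
    rw [hB, zero_sub, neg_eq_zero] at hB'
    rcases mul_eq_zero.1 hB' with h | h
    · linarith
    · exact h
  rw [hcs] at hs
  exact hr (pow_eq_zero_iff two_ne_zero |>.1 (by simpa using hs.symm))

theorem isBroom_of_energy_eq [Fintype V] [NeZero g] {q : ℝ} {k : ℕ} {x : V → ℝ}
    (R : G.RootedCycle g) (hg : 3 ≤ g) (hq0 : 0 < q) (hq1 : q < 1)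
    (htail : TailNonneg g q m k) (hk : 1 ≤ k) (hcard : Fintype.card V = g + m + k)
    (hdepth : ∀ v, R.depth v ≤ m + 1)
    (hlip : ∀ v w, G.Adj v w → R.depth v ≤ R.depth w + 1)
    (hchord : ∀ i j, G.Adj (R.cyc i) (R.cyc j) → j = i + 1 ∨ i = j + 1)
    (hx : x ≠ 0) (heq : G.energy x = q * ∑ v, x v ^ 2) :
    ∃ r u, R.IsBroom m r u := by
  obtain ⟨u, hum, hxu, hmax, hanc, hleaf, hexc, hform⟩ :=
    R.tight_of_energy_eq hg hq0 hq1 htail hk hcard hdepth hx heq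
  have hp : 0 < 1 - q := by linarith
  have hxu2 : 0 < x u ^ 2 := by positivity
  obtain ⟨r, hr⟩ := R.exists_cyc_eq_ancestor_zero u
  have hpl : ∀ v, R.depth v = m + 1 → R.parent v = u := by
    intro v hv
    have hdp := R.depth_parent v (by omega)
    rcases Nat.eq_zero_or_pos m with rfl | hm
    · obtain ⟨s, hs⟩ := (R.depth_eq_zero (R.parent v)).1 (by omega)
      obtain ⟨r', hr'⟩ := (R.depth_eq_zero u).1 hum
      rw [pathForm, Finset.sum_range_zero, add_zero, ← hr'] at hform
      have h1 := (hleaf v hv).2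
      rw [← hs, ← hr'] at h1
      rw [← hs, ← hr', htail.root_unique hq0 hq1 hk hform h1 (by rwa [hr'])]
    · have h1 := hanc (R.parent v) (by omega) (by omega)
      have h2 : R.depth (R.parent v) = R.depth u := by omega
      rw [h1, h2, R.ancestor_depth]
  -- The absolute value of `x` strictly decreases from the leaves to their common neighbour.
  have hleafval : ∀ v, R.depth v = m + 1 → x v = - x u / (1 - q) := fun v hv => by
    rw [(hleaf v hv).1, hpl v hv]
  have hleafsq : ∀ v, R.depth v = m + 1 → x u ^ 2 < x v ^ 2 := by
    intro v hv
    rw [hleafval v hv, div_pow, neg_sq, lt_div_iff₀ (by positivity)]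
    exact mul_lt_of_lt_one_right hxu2 (by nlinarith)
  have key : ∀ v w, G.Adj v w → R.depth v ≤ R.depth w → R.Arc v w ∨ R.Arc w v := by
    intro v w hvw hle
    by_contra hcon
    have hsum : x v + x w = 0 := by
      by_contra hne
      exact hcon (R.arc_of_excess_eq_zero hexc hvw hne)
    have hsq : x w ^ 2 = x v ^ 2 := by
      rw [show x w = - x v by linarith]; ring
    have hl := hlip w v hvw.symm
    have hdw := hdepth w
    rcases Nat.lt_or_ge m (R.depth w) with hwm | hwm
    · -- `w` is a leaf
      rcases Nat.lt_or_ge m (R.depth v) with hvm | hvm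
      · rw [hleafval v (by omega), hleafval w (by omega)] at hsum
        apply hxu
        field_simp at hsum
        linarith
      · have h1 := hleafsq w (by omega)
        have h2 := hmax v hvm
        linarith
    · by_cases hw0 : R.depth w = 0
      · obtain ⟨i, rfl⟩ := (R.depth_eq_zero v).1 (by omega)
        obtain ⟨j, rfl⟩ := (R.depth_eq_zero w).1 hw0
        rcases hchord i j hvw with rfl | rfl
        · exact hcon (Or.inl (Or.inl ⟨i, rfl, rfl⟩))
        · exact hcon (Or.inr (Or.inl ⟨j, rfl, rfl⟩))
      · have hw := hanc w hw0 hwm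
        by_cases hv0 : R.depth v = 0
        · -- An additional edge from the cycle to the path: the path may be shortened by its
          -- first vertex, whose neighbour on the path then is attached to `v`.
          obtain ⟨s, rfl⟩ := (R.depth_eq_zero v).1 hv0
          have hd1 : R.depth w = 1 := by omega
          rw [hd1] at hw
          have h1 := (htail.shorten hq0 hq1 1 (m - 1) (by omega) s (fun i => x (R.cyc i))
            (fun i => - x (R.ancestor u (i + 1))) (by
              simp only [zero_add, ← hw]; linarith)).2 le_rfl hk
          have hm1 : m - 1 + 1 = m := by omega
          have hanu : R.ancestor u m = u := by rw [← hum, R.ancestor_depth]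
          simp only [hm1, hanu, neg_sq, neg_ne_zero] at h1
          have h2 := h1 hxu
          have h3 : pathForm q (fun i => x (R.ancestor u i)) m =
              pathForm q (fun i => - x (R.ancestor u (i + 1))) (m - 1) +
                ((x w + x (R.ancestor u 0)) ^ 2 - q * x w ^ 2) := by
            rw [← hm1, pathForm, Finset.sum_range_succ', pathForm, hm1]
            simp only [zero_add, ← hw]
            congr 1
            exact Finset.sum_congr rfl fun i _ => by ring
          have h4 : q * x w ^ 2 ≤ q / (1 - q) * x u ^ 2 := by
            have h5 : x w ^ 2 ≤ x u ^ 2 := hmax w hwm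
            have h6 : q ≤ q / (1 - q) := by
              rw [le_div_iff₀ hp]; nlinarith
            have : 0 ≤ q / (1 - q) := by linarith
            exact mul_le_mul h6 h5 (sq_nonneg _) this
          rw [h3] at hform
          push_cast at h2
          nlinarith [sq_nonneg (x w + x (R.ancestor u 0))]
        · have hv := hanc v hv0 (by omega)
          rcases Nat.lt_or_ge (R.depth v) (R.depth w) with hlt | hge
          · refine hcon (Or.inr (Or.inr ⟨hw0, ?_⟩))
            have hdvw : R.depth w = R.depth v + 1 := by omega
            rw [hw, hdvw, R.parent_ancestor u (by omega), ← hv]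
          · apply hvw.ne
            rw [hv, hw, le_antisymm hle hge]
  refine ⟨r, u, hdepth, hum, hr.symm, hanc, hpl, ?_⟩
  intro v w hvw
  rcases Nat.le_total (R.depth v) (R.depth w) with hle | hle
  · exact key v w hvw hle
  · exact (key w v hvw.symm hle).symm

end RootedCycle

end SimpleGraph

namespace SimpleGraph

/-! ### The form of a broom on a cycle -/

theorem RootedCycle.qMin_pos {V : Type*} [Fintype V] {G : SimpleGraph V} {g : ℕ}
    (R : G.RootedCycle g) (hg : Odd g) : 0 < G.qMin := by
  have : Nonempty V := ⟨R.cyc 0⟩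
  obtain ⟨x, hx, hE⟩ := G.exists_energy_eq_qMin_mul
  have h1 := G.energy_nonneg x
  have h2 : 0 < ∑ v, x v ^ 2 := by
    obtain ⟨v, hv⟩ := Function.ne_iff.1 hx
    exact Finset.sum_pos' (fun _ _ => sq_nonneg _) ⟨v, Finset.mem_univ _, by
      have : x v ≠ 0 := hv
      positivity⟩
  have h3 : G.energy x ≠ 0 := fun h => hx (R.eq_zero_of_energy_eq_zero hg h)
  rw [hE] at h1 h3
  rcases lt_trichotomy G.qMin 0 with h | h | h
  · nlinarith
  · rw [h, zero_mul] at h3; exact absurd rfl h3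
  · exact h

namespace RootedCycle.IsBroom

variable {V : Type*} [Fintype V] {G : SimpleGraph V} {g : ℕ} [NeZero g] {R : G.RootedCycle g}
  {m : ℕ} {r : ZMod g} {u : V}

theorem card_offPath_eq (h : R.IsBroom m r u) {k : ℕ} (hcard : Fintype.card V = g + m + k) :
    (R.offPath u).card = k := by
  have := R.card_offPath u
  rw [h.depth_center] at this
  omega

/-- The form of a broom at the vector with values `c` on the cycle, `b` on the path and `t` at the
leaves. -/
theorem exists_energy_sub_eq (h : R.IsBroom m r u) (hg : 3 ≤ g) {k : ℕ}
    (hcard : Fintype.card V = g + m + k) (q : ℝ) (c : ZMod g → ℝ) (b : ℕ → ℝ) (t : ℝ)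
    (hcb : c r = b 0) :
    ∃ y : V → ℝ, G.energy y - q * ∑ v, y v ^ 2 =
      cycForm q c + pathForm q b m + k * ((t + b m) ^ 2 - q * t ^ 2) := by
  choose! idx hidx using fun v => (R.depth_eq_zero v).1
  let y : V → ℝ := fun v =>
    if R.depth v = 0 then c (idx v) else if R.depth v = m + 1 then t else b (R.depth v)
  have ycyc : ∀ i, y (R.cyc i) = c i := by
    intro i
    have h0 := R.depth_cyc i
    simp only [y, h0, if_true]
    rw [R.cyc_injective (hidx _ h0)]
  have yanc : ∀ i ≤ m, y (R.ancestor u i) = b i := by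
    intro i hi
    rcases Nat.eq_zero_or_pos i with rfl | hpos
    · rw [h.root, ycyc, hcb]
    · have hd := R.depth_ancestor u (i := i) (by rw [h.depth_center]; exact hi)
      simp only [y, hd, if_neg (show i ≠ 0 by omega), if_neg (show i ≠ m + 1 by omega)]
  have yu : y u = b m := by
    have := yanc m le_rfl
    rwa [← h.depth_center, R.ancestor_depth, h.depth_center] at this
  refine ⟨y, ?_⟩
  rw [R.energy_sub_eq_tail_add hg q 0 y u, R.excess_eq_zero h.arc_of_adj, h.depth_center,
    pathForm_congr yanc, Finset.sum_congr rfl (g := fun _ => (t + b m) ^ 2 - q * t ^ 2),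
    Finset.sum_const, h.card_offPath_eq hcard]
  · simp only [ycyc, nsmul_eq_mul]
    ring
  · intro v hv
    rw [h.mem_offPath_iff] at hv
    rw [h.parent_leaf v hv, yu]
    have : y v = t := by simp only [y, hv, if_true, if_neg (Nat.succ_ne_zero m)]
    rw [this]
    ring

/-- A leaf pushes the least eigenvalue below `1`. -/
theorem qMin_lt_one (h : R.IsBroom m r u) (hg : 3 ≤ g) {k : ℕ} (hk : 1 ≤ k)
    (hcard : Fintype.card V = g + m + k) : G.qMin < 1 := by
  have : Nonempty V := ⟨u⟩
  by_contra hq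
  push Not at hq
  -- with the value `1` off the leaves, the form tends to `-∞` with the value `t` at the leaves
  set A := cycForm G.qMin (fun _ : ZMod g => (1 : ℝ)) + pathForm G.qMin (fun _ => 1) m with hA
  obtain ⟨y, hy⟩ := h.exists_energy_sub_eq hg hcard G.qMin (fun _ => 1) (fun _ => 1)
    (-(|A| + 1)) rfl
  have h1 := G.qMin_mul_le_energy y
  rw [← hA] at hy
  have hk' : (1 : ℝ) ≤ k := by exact_mod_cast hk
  have h2 : (-(|A| + 1) + 1) ^ 2 - G.qMin * (-(|A| + 1)) ^ 2 ≤ -(2 * |A| + 1) := by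
    nlinarith [sq_nonneg (|A| + 1)]
  have h3 : (k : ℝ) * ((-(|A| + 1) + 1) ^ 2 - G.qMin * (-(|A| + 1)) ^ 2) ≤ -(2 * |A| + 1) := by
    nlinarith [abs_nonneg A]
  linarith [le_abs_self A, abs_nonneg A]

theorem tailNonneg (h : R.IsBroom m r u) (hg : 3 ≤ g) {k : ℕ}
    (hk : 1 ≤ k) (hcard : Fintype.card V = g + m + k) : TailNonneg g G.qMin m k := by
  have : Nonempty V := ⟨u⟩
  intro s c b hcb
  have hq := h.qMin_lt_one hg hk hcard
  obtain ⟨y, hy⟩ := h.exists_energy_sub_eq hg hcard G.qMin (fun i => c (i + (s - r))) b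
    (- b m / (1 - G.qMin)) (by simpa using hcb)
  have h1 := G.qMin_mul_le_energy y
  rw [cycForm_rotate] at hy
  have h2 : (- b m / (1 - G.qMin) + b m) ^ 2 - G.qMin * (- b m / (1 - G.qMin)) ^ 2 =
      - (G.qMin / (1 - G.qMin)) * b m ^ 2 := by
    have : 1 - G.qMin ≠ 0 := by linarith
    field_simp
    ring
  rw [h2] at hy
  linarith

end RootedCycle.IsBroom

end SimpleGraph

/-! ### The graph `U_n^k(g)` as a broom on a cycle -/

theorem ZMod.val_add_one_eq_ite {g : ℕ} [NeZero g] (i : ZMod g) :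
    (i + 1).val = if i.val + 1 = g then 0 else i.val + 1 := by
  have h : i + 1 = ((i.val + 1 : ℕ) : ZMod g) := by push_cast; rw [ZMod.natCast_zmod_val]
  have hlt := i.val_lt
  rw [h, ZMod.val_natCast]
  split_ifs with h1
  · rw [h1, Nat.mod_self]
  · exact Nat.mod_eq_of_lt (by omega)

theorem cyclePathStar_adj {n k g : ℕ} {i j : Fin n} : (cyclePathStar n k g).Adj i j ↔ i ≠ j ∧
    ((((j : ℕ) = i + 1 ∧ (j : ℕ) + k + 1 ≤ n) ∨ ((i : ℕ) = 0 ∧ (j : ℕ) + 1 = g) ∨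
      ((i : ℕ) + k + 1 = n ∧ (i : ℕ) < j)) ∨
    (((i : ℕ) = j + 1 ∧ (i : ℕ) + k + 1 ≤ n) ∨ ((j : ℕ) = 0 ∧ (i : ℕ) + 1 = g) ∨
      ((j : ℕ) + k + 1 = n ∧ (j : ℕ) < i))) := Iff.rfl

/-- The cycle of `U_n^k(g)` with the forest formed by the path and the star. -/
def cyclePathStar.rootedCycle {n k g : ℕ} [NeZero g] (hg : 3 ≤ g) (hk : 1 ≤ k) (hn : g + k ≤ n) :
    (cyclePathStar n k g).RootedCycle g where
  cyc i := ⟨i.val, by have := i.val_lt; omega⟩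
  cyc_injective i j h := ZMod.val_injective g (Fin.mk.inj_iff.1 h)
  cyc_adj i := by
    have h := i.val_add_one_eq_ite
    have hlt := i.val_lt
    rw [cyclePathStar_adj]
    simp only [ne_eq, Fin.mk.injEq]
    split_ifs at h <;> omega
  depth v := min (v : ℕ) (n - k) - (g - 1)
  depth_eq_zero v := by
    constructor
    · intro h
      have hv := v.2
      refine ⟨((v : ℕ) : ZMod g), Fin.ext ?_⟩
      exact ZMod.val_cast_of_lt (by omega)
    · rintro ⟨i, rfl⟩
      have := i.val_lt
      simp only
      omega
  parent v := ⟨min ((v : ℕ) - 1) (n - 1 - k), by omega⟩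
  parent_adj v hv := by
    have := v.2
    rw [cyclePathStar_adj]
    simp only [ne_eq, Fin.ext_iff]
    omega
  depth_parent v hv := by
    have := v.2
    simp only
    omega

theorem cyclePathStar.isBroom {n k g : ℕ} [NeZero g] (hg : 3 ≤ g) (hk : 1 ≤ k) (hn : g + k ≤ n) :
    (cyclePathStar.rootedCycle hg hk hn).IsBroom (n - g - k) (((g - 1 : ℕ) : ZMod g))
      ⟨n - 1 - k, by omega⟩ := by
  set R := cyclePathStar.rootedCycle hg hk hn with hR
  have hdep : ∀ v, R.depth v = min (v : ℕ) (n - k) - (g - 1) := fun _ => rfl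
  have hpar : ∀ v, (R.parent v : ℕ) = min ((v : ℕ) - 1) (n - 1 - k) := fun _ => rfl
  have hcyc : ∀ i, (R.cyc i : ℕ) = i.val := fun _ => rfl
  have hcenter : R.depth ⟨n - 1 - k, by omega⟩ = n - g - k := by
    rw [hdep]
    simp only
    omega
  have hval : ∀ i, i ≤ n - g - k → i ≠ 0 →
      (R.ancestor ⟨n - 1 - k, by omega⟩ i : ℕ) = g - 1 + i := by
    intro i hi h0
    have h1 := R.depth_ancestor ⟨n - 1 - k, by omega⟩ (i := i) (by rw [hcenter]; exact hi)
    rw [hdep] at h1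
    omega
  refine ⟨?_, hcenter, ?_, ?_, ?_, ?_⟩
  · intro v
    rw [hdep]
    omega
  · apply Fin.ext
    rw [hcyc, ZMod.val_cast_of_lt (by omega)]
    rcases Nat.eq_zero_or_pos (n - g - k) with h0 | h0
    · have : R.ancestor ⟨n - 1 - k, by omega⟩ 0 = ⟨n - 1 - k, by omega⟩ := by
        conv_lhs => rw [← h0, ← hcenter]
        exact R.ancestor_depth _
      rw [this]
      simp only
      omega
    · rw [← R.parent_ancestor _ (by rw [hcenter]; exact h0), hpar, hval _ (by omega) (by omega)]
      omega
  · intro v h0 hv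
    apply Fin.ext
    rw [hval _ hv h0]
    rw [hdep] at h0 hv ⊢
    omega
  · intro v hv
    apply Fin.ext
    rw [hpar]
    rw [hdep] at hv
    simp only
    omega
  · have key : ∀ v w : Fin n, v ≠ w → (((w : ℕ) = v + 1 ∧ (w : ℕ) + k + 1 ≤ n) ∨
        ((v : ℕ) = 0 ∧ (w : ℕ) + 1 = g) ∨ ((v : ℕ) + k + 1 = n ∧ (v : ℕ) < w)) →
        R.Arc v w ∨ R.Arc w v := by
      rintro v w - (⟨h1, h2⟩ | ⟨h1, h2⟩ | ⟨h1, h2⟩)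
      · by_cases hw : (w : ℕ) < g
        · refine Or.inl (Or.inl ⟨((v : ℕ) : ZMod g), Fin.ext ?_, Fin.ext ?_⟩)
          · rw [hcyc, ZMod.val_cast_of_lt (by omega)]
          · rw [hcyc, ZMod.val_add_one_eq_ite, ZMod.val_cast_of_lt (by omega),
              if_neg (by omega), h1]
        · refine Or.inr (Or.inr ⟨?_, Fin.ext ?_⟩)
          · rw [hdep]; omega
          · rw [hpar]; omega
      · refine Or.inr (Or.inl ⟨((w : ℕ) : ZMod g), Fin.ext ?_, Fin.ext ?_⟩)
        · rw [hcyc, ZMod.val_cast_of_lt (by omega)]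
        · rw [hcyc, ZMod.val_add_one_eq_ite, ZMod.val_cast_of_lt (by omega), if_pos h2, h1]
      · have := w.2
        refine Or.inr (Or.inr ⟨?_, Fin.ext ?_⟩)
        · rw [hdep]; omega
        · rw [hpar]; omega
    intro v w hvw
    rw [cyclePathStar_adj] at hvw
    rcases hvw.2 with h | h
    · exact key v w hvw.1 h
    · exact (key w v hvw.1.symm h).symm

namespace SimpleGraph

/-! ### Shortest odd cycles -/

section ShortestOddCycle

variable {V : Type*} {G : SimpleGraph V} {g : ℕ}

theorem exists_walk_length_eq_of_adj_succ {c : ZMod g → V} (hc : ∀ i, G.Adj (c i) (c (i + 1)))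
    (i : ZMod g) (d : ℕ) : ∃ p : G.Walk (c i) (c (i + d)), p.length = d := by
  induction d with
  | zero => exact ⟨Walk.nil.copy rfl (by simp), by simp⟩
  | succ d ih =>
    obtain ⟨p, hp⟩ := ih
    exact ⟨(p.concat (hc _)).copy rfl (by push_cast; rw [add_assoc]), by simp [hp]⟩

/-- The two arcs of a closed chain of length `g` between two of its vertices. -/
theorem exists_walks_of_adj_succ [NeZero g] {c : ZMod g → V}
    (hc : ∀ i, G.Adj (c i) (c (i + 1))) (i j : ZMod g) :
    (∃ p : G.Walk (c i) (c j), p.length = (j - i).val) ∧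
      ∃ p : G.Walk (c j) (c i), p.length = g - (j - i).val := by
  have hlt := (j - i).val_lt
  have hj : i + ((j - i).val : ZMod g) = j := by rw [ZMod.natCast_zmod_val]; ring
  have hi : j + ((g - (j - i).val : ℕ) : ZMod g) = i := by
    rw [Nat.cast_sub hlt.le, ZMod.natCast_zmod_val, ZMod.natCast_self]; ring
  obtain ⟨p, hp⟩ := exists_walk_length_eq_of_adj_succ hc i (j - i).val
  obtain ⟨p', hp'⟩ := exists_walk_length_eq_of_adj_succ hc j (g - (j - i).val)
  exact ⟨⟨p.copy rfl (by rw [hj]), by simpa using hp⟩,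
    ⟨p'.copy rfl (by rw [hi]), by simpa using hp'⟩⟩

theorem exists_cyc_of_isCycle [NeZero g] {v : V} {p : G.Walk v v} (hp : p.IsCycle)
    (hl : p.length = g) :
    ∃ c : ZMod g → V, Function.Injective c ∧ ∀ i, G.Adj (c i) (c (i + 1)) := by
  refine ⟨fun i => p.getVert i.val, ?_, ?_⟩
  · intro i j hij
    have hi := i.val_lt
    have hj := j.val_lt
    exact ZMod.val_injective g (hp.getVert_injOn' (by rw [Set.mem_ofPred_eq]; omega)
      (by rw [Set.mem_ofPred_eq]; omega) hij)
  · intro i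
    have hi := i.val_lt
    have hadj := p.adj_getVert_succ (i := i.val) (by omega)
    simp only [ZMod.val_add_one_eq_ite]
    split_ifs with h
    · have hend : p.getVert (i.val + 1) = p.getVert 0 := by
        rw [Walk.getVert_zero]
        exact p.getVert_of_length_le (by omega)
      rwa [hend] at hadj
    · exact hadj

variable [NeZero g] {c : ZMod g → V}

/-- A shortest odd cycle has no chords. -/
theorem eq_add_one_of_adj_of_odd_le (hg : Odd g)
    (hodd : ∀ (u : V) (p : G.Walk u u), Odd p.length → g ≤ p.length)
    (hc : ∀ i, G.Adj (c i) (c (i + 1))) {i j : ZMod g} (hij : G.Adj (c i) (c j)) :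
    j = i + 1 ∨ i = j + 1 := by
  obtain ⟨⟨p, hp⟩, ⟨p', hp'⟩⟩ := exists_walks_of_adj_succ hc i j
  have hlt := (j - i).val_lt
  have hj : ((j - i).val : ZMod g) = j - i := ZMod.natCast_zmod_val _
  have hparity := hodd _ (Walk.cons hij p')
  have hparity' := hodd _ (Walk.cons hij.symm p)
  rw [Walk.length_cons] at hparity hparity'
  rcases Nat.even_or_odd (j - i).val with hd | hd
  · have h1 := hparity' (by rw [hp]; exact hd.add_one)
    right
    rw [show (j - i).val = g - 1 by omega, Nat.cast_sub (by omega), ZMod.natCast_self,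
      Nat.cast_one] at hj
    linear_combination hj
  · have h1 := hparity (by rw [hp']; exact (Nat.Odd.sub_odd hg hd).add_one)
    obtain ⟨e, he⟩ := hd
    left
    rw [show (j - i).val = 1 by omega, Nat.cast_one] at hj
    linear_combination -hj

/-- Two vertices of a shortest odd cycle with a common neighbour have distance two on it. -/
theorem eq_add_two_of_adj_of_odd_le (hg : Odd g)
    (hodd : ∀ (u : V) (p : G.Walk u u), Odd p.length → g ≤ p.length)
    (hc : ∀ i, G.Adj (c i) (c (i + 1))) {i j : ZMod g} {s : V} (hi : G.Adj s (c i))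
    (hj : G.Adj s (c j)) (hne : i ≠ j) : j = i + 2 ∨ i = j + 2 := by
  obtain ⟨⟨p, hp⟩, ⟨p', hp'⟩⟩ := exists_walks_of_adj_succ hc i j
  have hlt := (j - i).val_lt
  have h0 : (j - i).val ≠ 0 := by
    rw [Ne, ZMod.val_eq_zero, sub_eq_zero]
    exact hne.symm
  have hv : ((j - i).val : ZMod g) = j - i := ZMod.natCast_zmod_val _
  have hparity := hodd _ (Walk.cons hi (p.concat hj.symm))
  have hparity' := hodd _ (Walk.cons hj (p'.concat hi.symm))
  rw [Walk.length_cons, Walk.length_concat] at hparity hparity'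
  rcases Nat.even_or_odd (j - i).val with hd | hd
  · have h1 := hparity' (by rw [hp']; exact (Nat.Odd.sub_even hlt.le hg hd).add_even even_two)
    obtain ⟨e, he⟩ := hd
    left
    rw [show (j - i).val = 2 by omega] at hv
    push_cast at hv
    linear_combination -hv
  · have h1 := hparity (by rw [hp]; exact hd.add_even even_two)
    obtain ⟨e, he⟩ := hd
    obtain ⟨f, hf⟩ := hg
    right
    rw [show (j - i).val = g - 2 by omega, Nat.cast_sub (by omega), ZMod.natCast_self] at hv
    push_cast at hv
    linear_combination hv

end ShortestOddCycle

/-! ### The breadth-first forest hung onto a cycle -/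

/-- In a connected graph the distance from a cycle is the depth of a rooted cycle. -/
theorem Connected.exists_rootedCycle {V : Type*} {G : SimpleGraph V} {g : ℕ} (hG : G.Connected)
    {c : ZMod g → V} (hinj : Function.Injective c) (hc : ∀ i, G.Adj (c i) (c (i + 1))) :
    ∃ R : G.RootedCycle g, R.cyc = c ∧ ∀ v w, G.Adj v w → R.depth v ≤ R.depth w + 1 := by
  let depth : V → ℕ := fun v => sInf (Set.range fun i => G.dist v (c i))
  have hmem : ∀ v, ∃ i, G.dist v (c i) = depth v := fun v => Nat.sInf_mem (Set.range_nonempty _)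
  have hle : ∀ v i, depth v ≤ G.dist v (c i) := fun v i => Nat.sInf_le ⟨i, rfl⟩
  have hlip : ∀ v w, G.Adj v w → depth v ≤ depth w + 1 := by
    intro v w hvw
    obtain ⟨i, hi⟩ := hmem w
    have h1 := hle v i
    have h2 := hG.dist_triangle (u := v) (v := w) (w := c i)
    rw [dist_eq_one_iff_adj.2 hvw] at h2
    omega
  have hpar : ∀ v, depth v ≠ 0 → ∃ w, G.Adj v w ∧ depth w + 1 = depth v := by
    intro v hv
    obtain ⟨i, hi⟩ := hmem v
    obtain ⟨p, hp⟩ := (hG v (c i)).exists_walk_length_eq_dist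
    cases p with
    | nil => rw [← hi, ← hp] at hv; exact absurd rfl hv
    | @cons _ w _ hadj p' =>
      refine ⟨w, hadj, ?_⟩
      rw [Walk.length_cons] at hp
      have h1 := hle w i
      have h2 := dist_le p'
      have h3 := hlip v w hadj
      omega
  choose! par hpar using hpar
  refine ⟨⟨c, hinj, hc, depth, ?_, par, fun v hv => (hpar v hv).1, fun v hv => (hpar v hv).2⟩,
    rfl, hlip⟩
  intro v
  constructor
  · intro h
    obtain ⟨i, hi⟩ := hmem v
    exact ⟨i, ((hG.dist_eq_zero_iff).1 (hi.trans h)).symm⟩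
  · rintro ⟨i, rfl⟩
    have := hle (c i) i
    rw [dist_self] at this
    omega

/-! ### Brooms on odd cycles have the prescribed odd girth -/

namespace RootedCycle

variable {V : Type*} {G : SimpleGraph V} {g : ℕ} {R : G.RootedCycle g}

theorem connected [NeZero g] (R : G.RootedCycle g) : G.Connected := by
  have hc : ∀ i, G.Reachable (R.cyc 0) (R.cyc i) := by
    intro i
    obtain ⟨p, -⟩ := exists_walk_length_eq_of_adj_succ R.cyc_adj 0 i.val
    rw [zero_add, ZMod.natCast_zmod_val] at p
    exact p.reachable
  have hd : ∀ d v, R.depth v = d → G.Reachable (R.cyc 0) v := by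
    intro d
    induction d with
    | zero =>
      intro v hv
      obtain ⟨i, rfl⟩ := (R.depth_eq_zero v).1 hv
      exact hc i
    | succ d ih =>
      intro v hv
      have h1 := R.depth_parent v (by omega)
      exact (ih (R.parent v) (by omega)).trans (R.parent_adj v (by omega)).symm.reachable
  have : Nonempty V := ⟨R.cyc 0⟩
  exact ⟨fun v w => (hd _ v rfl).symm.trans (hd _ w rfl)⟩

theorem exists_closed_walk (R : G.RootedCycle g) :
    ∃ p : G.Walk (R.cyc 0) (R.cyc 0), p.length = g := by
  obtain ⟨p, hp⟩ := exists_walk_length_eq_of_adj_succ R.cyc_adj 0 g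
  exact ⟨p.copy rfl (by simp), by simpa using hp⟩

variable {m : ℕ} {r : ZMod g} {u : V}

/-- The broom folds onto its cycle: it is mapped to `ZMod g` such that adjacent vertices have
images which differ by one. Hence a closed walk which is shorter than the cycle is mapped to a
closed walk which lifts to the integers, and has even length. -/
theorem IsBroom.le_length_of_odd (h : R.IsBroom m r u) (v : V) (p : G.Walk v v)
    (hp : Odd p.length) : g ≤ p.length := by
  choose! idx hidx using fun v => (R.depth_eq_zero v).1
  let ρ : V → ZMod g := fun v =>
    if R.depth v = 0 then idx v else if Even (R.depth v) then r else r + 1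
  have ρcyc : ∀ i, ρ (R.cyc i) = i := by
    intro i
    have h0 := R.depth_cyc i
    simp only [ρ, h0, if_true]
    exact R.cyc_injective (hidx _ h0)
  have hroot : ∀ v, R.depth v = 1 → R.parent v = R.cyc r := by
    intro v hv
    rcases Nat.eq_zero_or_pos m with rfl | hm
    · rw [h.parent_leaf v hv, ← h.root, ← h.depth_center, R.ancestor_depth]
    · rw [h.eq_ancestor v (by omega) (by omega), hv,
        R.parent_ancestor u (by rw [h.depth_center]; omega), h.root]
  have hstep : ∀ v w, R.Arc v w → ∃ e : ℤ, |e| = 1 ∧ ρ w = ρ v + e := by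
    rintro v w (⟨i, rfl, rfl⟩ | ⟨h0, rfl⟩)
    · exact ⟨1, by simp, by rw [ρcyc, ρcyc]; simp⟩
    · rcases Nat.lt_or_ge 1 (R.depth v) with h1 | h1
      · have h2 := R.depth_parent v h0
        have h3 : Even (R.depth (R.parent v)) ↔ ¬ Even (R.depth v) := by
          rw [← h2, Nat.even_add_one, not_not]
        by_cases hev : Even (R.depth v)
        · refine ⟨1, by simp, ?_⟩
          simp only [ρ, h0, if_false, if_neg (show R.depth (R.parent v) ≠ 0 by omega), h3, hev,
            if_true, not_true_eq_false]
          simp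
        · refine ⟨-1, by simp, ?_⟩
          simp only [ρ, h0, if_false, if_neg (show R.depth (R.parent v) ≠ 0 by omega), h3, hev,
            if_true, not_false_eq_true]
          simp
      · have h2 : R.depth v = 1 := by omega
        refine ⟨-1, by simp, ?_⟩
        rw [hroot v h2, ρcyc]
        simp [ρ, h2]
  have hadj : ∀ v w, G.Adj v w → ∃ e : ℤ, |e| = 1 ∧ ρ w = ρ v + e := by
    intro v w hvw
    rcases h.arc_of_adj v w hvw with ha | ha
    · exact hstep v w ha
    · obtain ⟨e, he, he'⟩ := hstep w v ha
      exact ⟨-e, by rwa [abs_neg], by rw [he']; push_cast; ring⟩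
  have hwalk : ∀ (v w : V) (p : G.Walk v w),
      ∃ e : ℤ, |e| ≤ p.length ∧ ρ w = ρ v + e ∧ (Even e ↔ Even p.length) := by
    intro v w p
    induction p with
    | nil => exact ⟨0, by simp, by simp, by simp⟩
    | @cons v x w hvx p ih =>
      obtain ⟨e, he1, he2, he3⟩ := ih
      obtain ⟨e', he1', he2'⟩ := hadj v x hvx
      refine ⟨e' + e, ?_, ?_, ?_⟩
      · rw [Walk.length_cons]
        push_cast
        have := abs_add_le e' e
        omega
      · rw [he2, he2']; push_cast; ring
      · have hodd : ¬ Even e' := by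
          rcases (abs_eq (by norm_num)).1 he1' with rfl | rfl <;> decide
        rw [Walk.length_cons, Int.even_add, Nat.even_add_one, he3]
        tauto
  obtain ⟨e, he1, he2, he3⟩ := hwalk v v p
  by_contra hlt
  have h0 : ((e : ℤ) : ZMod g) = 0 := by
    have : ρ v + (e : ZMod g) = ρ v + 0 := by rw [← he2, add_zero]
    exact add_left_cancel this
  rw [ZMod.intCast_zmod_eq_zero_iff_dvd] at h0
  have h1 : e = 0 := Int.eq_zero_of_abs_lt_dvd h0 (by omega)
  rw [h1] at he3
  exact Nat.not_even_iff_odd.2 hp (he3.1 (by simp))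

theorem IsBroom.isLeast_oddCycleLengths (h : R.IsBroom m r u) (hg : Odd g) :
    IsLeast G.oddCycleLengths g := by
  refine ⟨?_, ?_⟩
  · obtain ⟨p, hp⟩ := R.exists_closed_walk
    obtain ⟨v, c, hc, hodd, hle⟩ := p.exists_isCycle_odd_length_le (by rwa [hp])
    exact ⟨hg, v, c, hc, le_antisymm (hle.trans hp.le) (h.le_length_of_odd v c hodd)⟩
  · rintro l ⟨hl, v, c, -, rfl⟩
    exact h.le_length_of_odd v c hl

theorem not_isBipartite (R : G.RootedCycle g) (hg : Odd g) : ¬ G.IsBipartite := by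
  intro hb
  obtain ⟨p, hp⟩ := R.exists_closed_walk
  have := two_colorable_iff_forall_loop_even.1 hb _ p
  rw [hp] at this
  exact Nat.not_even_iff_odd.2 hg this

end RootedCycle

end SimpleGraph

namespace SimpleGraph

/-! ### Domination numbers and the depth of a shortest odd cycle -/

section Domination

variable {V : Type*} {G : SimpleGraph V}

theorem dominationNumber_le_card {S : Finset V} (hS : G.IsDominatingSet S) :
    G.dominationNumber ≤ S.card := Nat.sInf_le ⟨S, hS, rfl⟩

theorem exists_isDominatingSet_card_eq [Fintype V] (G : SimpleGraph V) :
    ∃ S : Finset V, G.IsDominatingSet S ∧ S.card = G.dominationNumber :=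
  Nat.sInf_mem (s := {m | ∃ S : Finset V, G.IsDominatingSet S ∧ S.card = m})
    ⟨_, Finset.univ, fun v hv => absurd (Finset.mem_univ v) hv, rfl⟩

variable {g : ℕ} [NeZero g]

open Classical in
/-- The indices of the vertices of the chain `c` in the closed neighbourhood of `s`. -/
noncomputable def dominatedIndices (G : SimpleGraph V) (c : ZMod g → V) (s : V) :
    Finset (ZMod g) :=
  Finset.univ.filter fun i => c i = s ∨ G.Adj (c i) s

theorem mem_dominatedIndices {c : ZMod g → V} {s : V} {i : ZMod g} :
    i ∈ G.dominatedIndices c s ↔ c i = s ∨ G.Adj (c i) s := by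
  simp [dominatedIndices]

variable {c : ZMod g → V}

/-- A vertex off a shortest odd cycle has at most one neighbour on the cycle, or its neighbours are
among three consecutive vertices of the cycle, including the outer two. -/
theorem dominatedIndices_of_notMem (hg : Odd g) (hg3 : 3 ≤ g)
    (hodd : ∀ (u : V) (p : G.Walk u u), Odd p.length → g ≤ p.length)
    (hc : ∀ i, G.Adj (c i) (c (i + 1))) {s : V} (hs : ∀ i, c i ≠ s) :
    (∃ i, G.dominatedIndices c s ⊆ {i}) ∨ ∃ i, G.Adj (c (i - 1)) s ∧ G.Adj (c (i + 1)) s ∧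
      G.dominatedIndices c s ⊆ {i - 1, i, i + 1} := by
  have hadj : ∀ {i}, i ∈ G.dominatedIndices c s → G.Adj (c i) s := fun {i} hi =>
    (mem_dominatedIndices.1 hi).resolve_left (hs i)
  have htwo : ∀ i ∈ G.dominatedIndices c s, ∀ j ∈ G.dominatedIndices c s, i ≠ j →
      j = i + 2 ∨ i = j + 2 := fun i hi j hj hne =>
    eq_add_two_of_adj_of_odd_le hg hodd hc (hadj hi).symm (hadj hj).symm hne
  by_cases hsub : ∀ i ∈ G.dominatedIndices c s, ∀ j ∈ G.dominatedIndices c s, i = j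
  · left
    rcases (G.dominatedIndices c s).eq_empty_or_nonempty with h | ⟨i, hi⟩
    · exact ⟨0, by simp [h]⟩
    · exact ⟨i, fun j hj => by simp [hsub j hj i hi]⟩
  · right
    obtain ⟨i, hi, hi2⟩ : ∃ i, i ∈ G.dominatedIndices c s ∧ i + 2 ∈ G.dominatedIndices c s := by
      push Not at hsub
      obtain ⟨i, hi, j, hj, hne⟩ := hsub
      rcases htwo i hi j hj hne with rfl | rfl
      · exact ⟨i, hi, hj⟩
      · exact ⟨j, hj, hi⟩
    refine ⟨i + 1, by simpa using hadj hi, ?_, ?_⟩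
    · have := hadj hi2
      rwa [show i + 1 + 1 = i + 2 by ring]
    · intro j hj
      simp only [Finset.mem_insert, Finset.mem_singleton]
      by_cases h1 : j = i
      · left; rw [h1]; ring
      by_cases h2 : j = i + 2
      · right; right; rw [h2]; ring
      -- a third neighbour makes `6` vanish in `ZMod g`, so that the cycle is a triangle
      have e1 : i = j + 2 := (htwo i hi j hj (Ne.symm h1)).resolve_left h2
      have e2 : j = i + 2 + 2 := (htwo (i + 2) hi2 j hj (Ne.symm h2)).resolve_right fun h =>
        h1 (add_right_cancel h).symm
      have h6 : ((6 : ℕ) : ZMod g) = 0 := by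
        push_cast
        linear_combination -e1 - e2
      rw [ZMod.natCast_eq_zero_iff] at h6
      have hle := Nat.le_of_dvd (by norm_num) h6
      have hg3' : g = 3 := by
        obtain ⟨a, ha⟩ := hg
        interval_cases g <;> omega
      subst hg3'
      have h3 : (3 : ZMod 3) = 0 := by decide
      right; left
      linear_combination e2 + h3

theorem card_dominatedIndices_le (hg : Odd g) (hg3 : 3 ≤ g)
    (hodd : ∀ (u : V) (p : G.Walk u u), Odd p.length → g ≤ p.length)
    (hinj : Function.Injective c) (hc : ∀ i, G.Adj (c i) (c (i + 1))) (s : V) :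
    (G.dominatedIndices c s).card ≤ 3 := by
  by_cases hs : ∃ i, c i = s
  · obtain ⟨i, rfl⟩ := hs
    have : G.dominatedIndices c (c i) ⊆ {i - 1, i, i + 1} := by
      intro j hj
      simp only [Finset.mem_insert, Finset.mem_singleton]
      rcases mem_dominatedIndices.1 hj with h | h
      · exact Or.inr (Or.inl (hinj h))
      · rcases eq_add_one_of_adj_of_odd_le hg hodd hc h with h | h
        · left; rw [h]; ring
        · right; right; exact h
    exact (Finset.card_le_card this).trans Finset.card_le_three
  · push Not at hs
    rcases dominatedIndices_of_notMem hg hg3 hodd hc hs with ⟨i, h⟩ | ⟨i, -, -, h⟩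
    · exact (Finset.card_le_card h).trans (by simp)
    · exact (Finset.card_le_card h).trans Finset.card_le_three

/-- A set which dominates a shortest odd cycle has at least `g / 3` elements. If the cycle has as
many vertices in a dominating set `S` as possible, then a vertex of `S` off the cycle is almost
wasted: if it has two neighbours on the cycle, it can be exchanged for the cycle vertex between
them, which therefore belongs to `S`. -/
theorem add_two_le_of_maximal (hg : Odd g) (hg3 : 3 ≤ g)
    (hodd : ∀ (u : V) (p : G.Walk u u), Odd p.length → g ≤ p.length)
    (hinj : Function.Injective c) (hc : ∀ i, G.Adj (c i) (c (i + 1))) {S A : Finset V}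
    (hmax : ∀ c' : ZMod g → V, Function.Injective c' → (∀ i, G.Adj (c' i) (c' (i + 1))) →
      (∀ i, c i ∈ S → c' i ∈ S) → ∀ i, c' i ∈ S → c i ∈ S)
    (hcov : ∀ i, ∃ s ∈ A, i ∈ G.dominatedIndices c s) (hA : ∀ i, c i ∈ S → c i ∈ A)
    (hAS : A ⊆ S) :
    g ≤ 3 * A.card ∧ ∀ s ∈ A, (∀ i, c i ≠ s) → g + 2 ≤ 3 * A.card := by
  classical
  have h3 := card_dominatedIndices_le hg hg3 hodd hinj hc
  have hbi : ∀ B : Finset V, (B.biUnion (G.dominatedIndices c)).card ≤ B.card * 3 :=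
    fun B => Finset.card_biUnion_le_card_mul _ _ _ fun s _ => h3 s
  have hcard : (Finset.univ : Finset (ZMod g)).card = g := by rw [Finset.card_univ, ZMod.card]
  constructor
  · have : (Finset.univ : Finset (ZMod g)) ⊆ A.biUnion (G.dominatedIndices c) := by
      intro i _
      obtain ⟨s, hs, hi⟩ := hcov i
      exact Finset.mem_biUnion.2 ⟨s, hs, hi⟩
    have := (Finset.card_le_card this).trans (hbi A)
    omega
  · intro s hs hsc
    have hpos : 0 < A.card := Finset.card_pos.2 ⟨s, hs⟩
    have herase := Finset.card_erase_of_mem hs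
    rcases dominatedIndices_of_notMem hg hg3 hodd hc hsc with ⟨i, h⟩ | ⟨i, hi1, hi2, h⟩
    · have : (Finset.univ : Finset (ZMod g)) ⊆
          {i} ∪ (A.erase s).biUnion (G.dominatedIndices c) := by
        intro j _
        obtain ⟨t, ht, hj⟩ := hcov j
        rw [Finset.mem_union]
        by_cases hts : t = s
        · left; exact h (hts ▸ hj)
        · right; exact Finset.mem_biUnion.2 ⟨t, Finset.mem_erase.2 ⟨hts, ht⟩, hj⟩
      have h1 := (Finset.card_le_card this).trans (Finset.card_union_le _ _)
      have h2 := hbi (A.erase s)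
      rw [Finset.card_singleton] at h1
      omega
    · have hone : (1 : ZMod g) ≠ 0 := by
        have : Fact (1 < g) := ⟨by omega⟩
        exact one_ne_zero
      have hciS : c i ∈ S := by
        refine hmax (Function.update c i s) ?_ ?_ ?_ i (by simpa using hAS hs)
        · intro a b hab
          by_cases ha : a = i <;> by_cases hb : b = i
          · rw [ha, hb]
          · subst ha
            rw [Function.update_self, Function.update_of_ne hb] at hab
            exact absurd hab.symm (hsc b)
          · subst hb
            rw [Function.update_self, Function.update_of_ne ha] at hab
            exact absurd hab (hsc a)
          · rw [Function.update_of_ne ha, Function.update_of_ne hb] at hab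
            exact hinj hab
        · intro a
          by_cases ha : a = i
          · subst ha
            rw [Function.update_self, Function.update_of_ne (by simpa using hone)]
            exact hi2.symm
          · by_cases hb : a + 1 = i
            · subst hb
              rw [Function.update_self, Function.update_of_ne ha]
              simpa using hi1
            · rw [Function.update_of_ne ha, Function.update_of_ne hb]
              exact hc a
        · intro a ha
          by_cases hai : a = i
          · subst hai; simpa using hAS hs
          · rwa [Function.update_of_ne hai]
      have hsub : G.dominatedIndices c s ⊆ G.dominatedIndices c (c i) := by
        intro j hj
        have := h hj
        simp only [Finset.mem_insert, Finset.mem_singleton] at this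
        rw [mem_dominatedIndices]
        rcases this with rfl | rfl | rfl
        · right; simpa using hc (i - 1)
        · left; rfl
        · right; exact (hc i).symm
      have : (Finset.univ : Finset (ZMod g)) ⊆ (A.erase s).biUnion (G.dominatedIndices c) := by
        intro j _
        obtain ⟨t, ht, hj⟩ := hcov j
        by_cases hts : t = s
        · exact Finset.mem_biUnion.2 ⟨c i, Finset.mem_erase.2 ⟨hsc i, hA i hciS⟩,
            hsub (hts ▸ hj)⟩
        · exact Finset.mem_biUnion.2 ⟨t, Finset.mem_erase.2 ⟨hts, ht⟩, hj⟩
      have h1 := (Finset.card_le_card this).trans (hbi (A.erase s))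
      omega

/-- The depth of a suitable shortest odd cycle is bounded in terms of the domination number. -/
theorem exists_rootedCycle_add_depth_le [Fintype V] (hG : G.Connected) (hg : Odd g) (hg3 : 3 ≤ g)
    (hleast : IsLeast G.oddCycleLengths g) :
    ∃ R : G.RootedCycle g, (∀ v w, G.Adj v w → R.depth v ≤ R.depth w + 1) ∧
      (∀ i j, G.Adj (R.cyc i) (R.cyc j) → j = i + 1 ∨ i = j + 1) ∧
      ∀ v, g + R.depth v ≤ 3 * G.dominationNumber + if 3 ∣ g then 1 else 0 := by
  classical
  have hodd : ∀ (u : V) (p : G.Walk u u), Odd p.length → g ≤ p.length :=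
    fun u p => le_length_of_isLeast_oddCycleLengths hleast p
  obtain ⟨S, hS, hScard⟩ := G.exists_isDominatingSet_card_eq
  obtain ⟨-, v₀, p₀, hp₀, hl₀⟩ := hleast.1
  obtain ⟨c₀, hinj₀, hc₀⟩ := exists_cyc_of_isCycle hp₀ hl₀
  -- a shortest odd cycle with as many vertices as possible in `S`
  have : Nonempty {c : ZMod g → V // Function.Injective c ∧ ∀ i, G.Adj (c i) (c (i + 1))} :=
    ⟨⟨c₀, hinj₀, hc₀⟩⟩
  obtain ⟨⟨c, hinj, hc⟩, hcmax⟩ := Finite.exists_max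
    (fun c : {c : ZMod g → V // Function.Injective c ∧ ∀ i, G.Adj (c i) (c (i + 1))} =>
      (Finset.univ.filter fun i => c.1 i ∈ S).card)
  have hmax : ∀ c' : ZMod g → V, Function.Injective c' → (∀ i, G.Adj (c' i) (c' (i + 1))) →
      (∀ i, c i ∈ S → c' i ∈ S) → ∀ i, c' i ∈ S → c i ∈ S := by
    intro c' hinj' hc' hsub i hi
    have h1 := hcmax ⟨c', hinj', hc'⟩
    have h2 := Finset.eq_of_subset_of_card_le (s := Finset.univ.filter fun i => c i ∈ S)
      (t := Finset.univ.filter fun i => c' i ∈ S)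
      (fun j hj => by
        rw [Finset.mem_filter] at hj ⊢
        exact ⟨hj.1, hsub j hj.2⟩) h1
    have h3 : i ∈ Finset.univ.filter fun i => c' i ∈ S := by simpa using hi
    rw [← h2] at h3
    simpa using h3
  obtain ⟨R, hRc, hlip⟩ := hG.exists_rootedCycle hinj hc
  refine ⟨R, hlip, fun i j hij => ?_, fun w => ?_⟩
  · rw [hRc] at hij
    exact eq_add_one_of_adj_of_odd_le hg hodd hc hij
  have hdom : ∀ v, ∃ s ∈ S, s = v ∨ G.Adj v s := by
    intro v
    by_cases hv : v ∈ S
    · exact ⟨v, hv, Or.inl rfl⟩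
    · obtain ⟨s, hs, hvs⟩ := hS v hv
      exact ⟨s, hs, Or.inr hvs⟩
  choose dom hdomS hdom using hdom
  have hdd : ∀ v, R.depth (dom v) ≤ R.depth v + 1 ∧ R.depth v ≤ R.depth (dom v) + 1 := by
    intro v
    rcases hdom v with h | h
    · rw [h]; omega
    · exact ⟨hlip _ _ h.symm, hlip _ _ h⟩
  have hdc : ∀ i, R.depth (c i) = 0 := fun i => hRc ▸ R.depth_cyc i
  set A := S.filter fun s => R.depth s ≤ 1 with hA
  set B := S.filter fun s => ¬ R.depth s ≤ 1 with hB
  have hAB : A.card + B.card = S.card := Finset.card_filter_add_card_filter_not _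
  obtain ⟨hcyc1, hcyc2⟩ := add_two_le_of_maximal (A := A) hg hg3 hodd hinj hc hmax
    (fun i => ⟨dom (c i), by
      rw [hA, Finset.mem_filter]
      have := (hdd (c i)).1
      rw [hdc] at this
      exact ⟨hdomS _, this⟩, by
      rw [mem_dominatedIndices]
      exact (hdom (c i)).imp Eq.symm id⟩)
    (fun i hi => by rw [hA, Finset.mem_filter, hdc]; exact ⟨hi, by omega⟩)
    (Finset.filter_subset _ _)
  -- the indices of the path to `w`, according to the depth of the dominating vertex
  have hanc : ∀ j ∈ Finset.Icc 1 (R.depth w), R.depth (R.ancestor w j) = j :=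
    fun j hj => R.depth_ancestor w (Finset.mem_Icc.1 hj).2
  set J₁ := (Finset.Icc 1 (R.depth w)).filter fun j => R.depth (dom (R.ancestor w j)) ≤ 1 with hJ₁
  set J₂ := (Finset.Icc 1 (R.depth w)).filter
    fun j => ¬ R.depth (dom (R.ancestor w j)) ≤ 1 with hJ₂
  have hJ : J₁.card + J₂.card = R.depth w := by
    rw [hJ₁, hJ₂, Finset.card_filter_add_card_filter_not, Nat.card_Icc]
    omega
  have hJ₂le : J₂.card ≤ 3 * B.card := by
    refine Finset.card_le_mul_card_image_of_maps_to (f := fun j => dom (R.ancestor w j)) ?_ 3 ?_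
    · intro j hj
      rw [hJ₂, Finset.mem_filter] at hj
      rw [hB, Finset.mem_filter]
      exact ⟨hdomS _, hj.2⟩
    · intro b _
      have : J₂.filter (fun j => dom (R.ancestor w j) = b) ⊆
          Finset.Icc (R.depth b - 1) (R.depth b + 1) := by
        intro j hj
        rw [Finset.mem_filter, hJ₂, Finset.mem_filter] at hj
        have h1 := hdd (R.ancestor w j)
        rw [hj.2, hanc j hj.1.1] at h1
        rw [Finset.mem_Icc]
        omega
      refine (Finset.card_le_card this).trans ?_
      rw [Nat.card_Icc]
      omega
  have hJ₁le : ∀ j ∈ J₁, 1 ≤ j ∧ j ≤ 2 := by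
    intro j hj
    rw [hJ₁, Finset.mem_filter] at hj
    have h1 := (hdd (R.ancestor w j)).2
    rw [hanc j hj.1] at h1
    have := Finset.mem_Icc.1 hj.1
    omega
  rw [← hScard]
  by_cases h2 : 2 ∈ J₁
  · have hcard : J₁.card ≤ 2 := by
      have : J₁ ⊆ Finset.Icc 1 2 := fun j hj => Finset.mem_Icc.2 (hJ₁le j hj)
      simpa using Finset.card_le_card this
    rw [hJ₁, Finset.mem_filter] at h2
    have h3 := (hdd (R.ancestor w 2)).2
    rw [hanc 2 h2.1] at h3
    have h4 := hcyc2 (dom (R.ancestor w 2)) (by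
      rw [hA, Finset.mem_filter]; exact ⟨hdomS _, h2.2⟩) (by
      intro i hi
      have := hdc i
      rw [hi] at this
      omega)
    omega
  · have hcard : J₁.card ≤ 1 := by
      have : J₁ ⊆ {1} := by
        intro j hj
        rw [Finset.mem_singleton]
        have := hJ₁le j hj
        have hne : j ≠ 2 := fun h => h2 (h ▸ hj)
        omega
      simpa using Finset.card_le_card this
    split_ifs with h3 <;> omega

end Domination

end SimpleGraph

/-! ### The domination number of `U_n^k(g)` -/

/-- The path of `U_n^k(g)` through all vertices but `k - 1` leaves is dominated by every third of
its vertices, where the last one is moved to the centre of the star. If `g` is a multiple of three,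
then the first vertex is dominated by way of the edge that closes the cycle. -/
theorem cyclePathStar.dominationNumber_le {n k g t : ℕ} (hg : 3 ≤ g) (hk : 1 ≤ k)
    (hn : g + k ≤ n) (ht : n - k + 1 ≤ 3 * t + if 3 ∣ g then 1 else 0) :
    (cyclePathStar n k g).dominationNumber ≤ t := by
  classical
  set e := if 3 ∣ g then 2 else 1 with he
  let f : ℕ → Fin n := fun i => ⟨min (3 * i + e) (n - 1 - k), by omega⟩
  have hfval : ∀ i, (f i : ℕ) = min (3 * i + e) (n - 1 - k) := fun _ => rfl
  have hdom : (cyclePathStar n k g).IsDominatingSet ((Finset.range t).image f) := by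
    intro v hv
    have hvn := v.2
    have key : ∃ i < t, f i = v ∨ (cyclePathStar n k g).Adj v (f i) := by
      simp only [cyclePathStar_adj, ne_eq, Fin.ext_iff, hfval]
      by_cases h3 : 3 ∣ g
      · rw [if_pos h3] at ht he
        rw [he]
        by_cases hv0 : (v : ℕ) = 0
        · exact ⟨g / 3 - 1, by omega, by omega⟩
        · exact ⟨(min (v : ℕ) (n - k) - 1) / 3, by omega, by omega⟩
      · rw [if_neg h3] at ht he
        rw [he]
        exact ⟨min (v : ℕ) (n - k) / 3, by omega, by omega⟩
    obtain ⟨i, hi, hiv⟩ := key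
    have hmem : f i ∈ (Finset.range t).image f :=
      Finset.mem_image.2 ⟨i, Finset.mem_range.2 hi, rfl⟩
    exact ⟨f i, hmem, hiv.resolve_left fun h => hv (h ▸ hmem)⟩
  refine (SimpleGraph.dominationNumber_le_card hdom).trans ?_
  simpa using Finset.card_image_le (s := Finset.range t) (f := f)

theorem cyclePathStar.dominationNumber_le_succ {n k g : ℕ} (hk : 1 ≤ k)
    (hn : g + (k + 1) ≤ n) : (cyclePathStar n k g).dominationNumber ≤
      (cyclePathStar n (k + 1) g).dominationNumber + 1 := by
  classical
  obtain ⟨S, hS, hcard⟩ := (cyclePathStar n (k + 1) g).exists_isDominatingSet_card_eq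
  -- the new centre dominates all leaves and the previous centre
  set z : Fin n := ⟨n - 1 - k, by omega⟩ with hz
  have hzval : (z : ℕ) = n - 1 - k := rfl
  have hdom : (cyclePathStar n k g).IsDominatingSet (insert z S) := by
    intro v hv
    rw [Finset.mem_insert, not_or] at hv
    have hvz : (v : ℕ) ≠ n - 1 - k := fun h => hv.1 (Fin.ext h)
    have hvn := v.2
    obtain ⟨u, hu, hvu⟩ := hS v hv.2
    have hun := u.2
    rw [cyclePathStar_adj, ne_eq, Fin.ext_iff] at hvu
    rcases Nat.lt_or_ge (n - 1 - k) v with hv1 | hv1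
    · refine ⟨z, Finset.mem_insert_self _ _, ?_⟩
      rw [cyclePathStar_adj, ne_eq, Fin.ext_iff, hzval]
      exact ⟨hvz, Or.inr (Or.inr (Or.inr ⟨by omega, hv1⟩))⟩
    · rcases Nat.lt_or_ge u (n - 1 - k) with hu1 | hu1
      · refine ⟨u, Finset.mem_insert_of_mem hu, ?_⟩
        rw [cyclePathStar_adj, ne_eq, Fin.ext_iff]
        refine ⟨hvu.1, hvu.2.imp ?_ ?_⟩ <;> omega
      · refine ⟨z, Finset.mem_insert_self _ _, ?_⟩
        rw [cyclePathStar_adj, ne_eq, Fin.ext_iff, hzval]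
        exact ⟨hvz, Or.inl (Or.inl ⟨by omega, by omega⟩)⟩
  rw [← hcard]
  exact (SimpleGraph.dominationNumber_le_card hdom).trans (Finset.card_insert_le _ _)

/-- A discrete intermediate value theorem: the domination number of `U_n^k(g)` increases by at
most one when `k` decreases by one. -/
theorem exists_mem_leafCounts_le {n γ g : ℕ} (hγ : γ ≤ (cyclePathStar n 1 g).dominationNumber)
    (k : ℕ) (hk : 1 ≤ k) (hn : g + k ≤ n) (hle : (cyclePathStar n k g).dominationNumber ≤ γ) :
    ∃ k' ∈ leafCounts n γ g, k' ≤ k := by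
  induction k, hk using Nat.le_induction with
  | base => exact ⟨1, ⟨le_rfl, by omega, le_antisymm hle hγ⟩, le_rfl⟩
  | succ k hk ih =>
    by_cases heq : (cyclePathStar n (k + 1) g).dominationNumber = γ
    · exact ⟨k + 1, ⟨by omega, by omega, heq⟩, le_rfl⟩
    · have h := cyclePathStar.dominationNumber_le_succ hk hn
      obtain ⟨k', hk', hle'⟩ := ih (by omega) (by omega)
      exact ⟨k', hk', by omega⟩

/-! ### The extremal graph -/

theorem mainTheorem3 (n γ g : ℕ) (hg : Odd g) (hg3 : 3 ≤ g) (hgn : g < n)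
    (hγ : ⌈(g : ℝ) / 3⌉₊ ≤ γ) (hγg : γ ≤ (cyclePathStar n 1 g).dominationNumber) :
    (leafCounts n γ g).Nonempty ∧
    (extremalGraph n γ g).InClass n γ g ∧
    ∀ (W : Type*) [Fintype W] (G : SimpleGraph W), G.InClass n γ g →
      (extremalGraph n γ g).qMin ≤ G.qMin ∧
      (G.qMin = (extremalGraph n γ g).qMin ↔ Nonempty (G ≃g extremalGraph n γ g)) := by
  have : NeZero g := ⟨by omega⟩
  have hgγ : g ≤ 3 * γ := by
    have h1 : (g : ℝ) / 3 ≤ γ := Nat.ceil_le.1 hγ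
    have h2 : (g : ℝ) ≤ ((3 * γ : ℕ) : ℝ) := by push_cast; linarith
    exact_mod_cast h2
  have hne : (leafCounts n γ g).Nonempty := by
    obtain ⟨k, hk, -⟩ := exists_mem_leafCounts_le hγg (n - g) (by omega) (by omega)
      (cyclePathStar.dominationNumber_le hg3 (by omega) (by omega) (by split_ifs <;> omega))
    exact ⟨k, hk⟩
  obtain ⟨hk1, hkn, hkγ⟩ := Nat.sInf_mem hne
  have hmin : ∀ k, 1 ≤ k → g + k ≤ n → (cyclePathStar n k g).dominationNumber ≤ γ →
      sInf (leafCounts n γ g) ≤ k := by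
    intro k h1 h2 h3
    obtain ⟨k', hk', hle⟩ := exists_mem_leafCounts_le hγg k h1 h2 h3
    exact (Nat.sInf_le hk').trans hle
  rw [extremalGraph]
  set k := sInf (leafCounts n γ g) with hk
  have hgk : g + k ≤ n := by omega
  have hbroom := cyclePathStar.isBroom hg3 hk1 hgk
  set R := cyclePathStar.rootedCycle hg3 hk1 hgk with hR
  refine ⟨hne, ⟨Fintype.card_fin n, R.connected, R.not_isBipartite hg, hkγ,
    hbroom.isLeast_oddCycleLengths hg⟩, ?_⟩
  intro W _ G hG
  have hcardU : Fintype.card (Fin n) = g + (n - g - k) + k := by rw [Fintype.card_fin]; omega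
  have hq0 := R.qMin_pos hg
  have hq1 := hbroom.qMin_lt_one hg3 hk1 hcardU
  have htail := hbroom.tailNonneg hg3 hk1 hcardU
  have hcardW : Fintype.card W = g + (n - g - k) + k := by rw [hG.order]; omega
  obtain ⟨R', hlip, hchord, hdep⟩ :=
    SimpleGraph.exists_rootedCycle_add_depth_le hG.connected hg hg3 hG.odd_girth
  rw [hG.domination] at hdep
  have hdepth : ∀ v, R'.depth v ≤ n - g - k + 1 := by
    intro v
    rcases Nat.eq_zero_or_pos (R'.depth v) with h0 | hpos
    · omega
    · -- the graph with a path as long as the depth of `v` has domination number at most `γ`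
      have hle := R'.add_depth_le_card v
      rw [hG.order] at hle
      have hv := hdep v
      have h1 := hmin (n + 1 - g - R'.depth v) (by omega) (by omega)
        (cyclePathStar.dominationNumber_le hg3 (by omega) (by omega) (by omega))
      omega
  have : Nonempty W := hG.connected.nonempty
  obtain ⟨x, hx, hE⟩ := G.exists_energy_eq_qMin_mul
  have hsum : 0 < ∑ v, x v ^ 2 := by
    obtain ⟨v, hv⟩ := Function.ne_iff.1 hx
    exact Finset.sum_pos' (fun _ _ => sq_nonneg _) ⟨v, Finset.mem_univ _, by
      have : x v ≠ 0 := hv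
      positivity⟩
  constructor
  · have h := R'.le_energy hg3 hq0 hq1 htail hcardW hdepth x
    rw [hE] at h
    exact le_of_mul_le_mul_right h hsum
  · constructor
    · intro heq
      obtain ⟨r, u, hbroom'⟩ := R'.isBroom_of_energy_eq hg3 hq0 hq1 htail hk1 hcardW hdepth hlip
        hchord hx (heq ▸ hE)
      exact hbroom'.nonempty_iso hbroom (by rw [hcardW, hcardU])
    · rintro ⟨e⟩
      exact e.qMin_eq
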